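/- Let $d\ge 1$ and $k\ge 1$ be integers and $\mathcal Q=[0,1]^d$. Let $p$ be a probability density on $\mathbb R^d$ that vanishes outside $\mathcal Q$, is continuous on $\mathcal Q$ and differentiable in the interior $\mathcal Q^{\circ}$, with $$C_1=\inf_{x\in\mathcal Q}p(x)>0,\qquad C_2=\sup_{x\in\mathcal Q^{\circ}}\|\nabla p(x)\|_1<\infty ,$$ and let $H(X)=-\int_{\mathcal Q}p(x)\log p(x)\,dx$ be its entropy. For $N>k$ let $x^{(1)},\dots,x^{(N)}$ be i.i.d. random vectors with density $p$. For each $i$ let $\epsilon_i$ be twice the distance, in the maximum norm, from $x^{(i)}$ to its $k$-th nearest neighbour among the other $N-1$ points, and for $1\le j\le d$ put $$\xi_{i,j}=\min\{x^{(i)}_j+\epsilon_i/2,\,1\}-\max\{x^{(i)}_j-\epsilon_i/2,\,0\}.$$ The truncated Kozachenko–Leonenko estimator is $$\widehat H_{\mathrm{tKL}}(X)=-\psi(k)+\psi(N)+\frac1N\sum_{i=1}^N\sum_{j=1}^d\log\xi_{i,j},\qquad \psi=\Gamma'/\Gamma .$$ Then $\widehat H_{\mathrm{tKL}}(X)$ is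 square integrable, and for every $N>k$ its bias satisfies $$\bigl|\mathbb E[\widehat H_{\mathrm{tKL}}(X)]-H(X)\bigr|\le \frac{C_2}{C_1^{1+1/d}}\Bigl(\frac kN\Bigr)^{1/d}.$$ Moreover, there is a constant $C>0$, depending on $p$, $k$ and $d$ but not on $N$, such that for every $N>k$ $$\mathrm{Var}[\widehat H_{\mathrm{tKL}}(X)]\le C\,\frac1N .$$ -/

import Mathlib

open MeasureTheory ProbabilityTheory

noncomputable section

namespace TruncatedKL

/-- The closed unit cube `[0,1]^d`. -/
def unitCube (d : ℕ) : Set (Fin d → ℝ) := Set.Icc 0 1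

/-- The `ℓ¹`-norm of the gradient of `p` at `x`, that is, the sum of the absolute values of the
partial derivatives of `p` at `x`. -/
def gradL1 {d : ℕ} (p : (Fin d → ℝ) → ℝ) (x : Fin d → ℝ) : ℝ :=
  ∑ j : Fin d, |fderiv ℝ p x (Pi.single j 1)|

/-- `p` is a probability density on `ℝ^d` that is supported on the unit cube, continuous on the
cube, bounded below on the cube with infimum `C₁ > 0`, and differentiable in the interior of the
cube, where the `ℓ¹`-norm of its gradient has the (finite) supremum `C₂`. -/
structure IsAdmissibleDensity {d : ℕ} (p : (Fin d → ℝ) → ℝ) (C₁ C₂ : ℝ) : Prop where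
  integral_eq_one : ∫ x, p x = 1
  support_subset : Function.support p ⊆ unitCube d
  continuousOn : ContinuousOn p (unitCube d)
  isGLB : IsGLB (p '' unitCube d) C₁
  pos : 0 < C₁
  differentiableOn : DifferentiableOn ℝ p (interior (unitCube d))
  isLUB : IsLUB (gradL1 p '' interior (unitCube d)) C₂

/-- The differential entropy `-∫ p log p` of a density on `ℝ^d`. -/
def entropy {d : ℕ} (p : (Fin d → ℝ) → ℝ) : ℝ := -∫ x, Real.log (p x) * p x

/-- The probability measure on `ℝ^d` with Lebesgue density `p`. -/
def law {d : ℕ} (p : (Fin d → ℝ) → ℝ) : Measure (Fin d → ℝ) :=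
  volume.withDensity fun x => ENNReal.ofReal (p x)

/-- The digamma function `ψ = Γ' / Γ` on the reals. -/
def digamma (x : ℝ) : ℝ := deriv Real.Gamma x / Real.Gamma x

/-- The distance, in the maximum norm, from the `i`-th sample point to its `k`-th nearest neighbour
among the other sample points: the least radius `r` such that at least `k` of the points `x j`,
`j ≠ i`, are within distance `r` of `x i`. (`dist` on `Fin d → ℝ` is the maximum-norm distance.) -/
def knnDist {N d : ℕ} (k : ℕ) (x : Fin N → Fin d → ℝ) (i : Fin N) : ℝ :=
  sInf {r : ℝ | k ≤ (Finset.univ.filter fun j => j ≠ i ∧ dist (x j) (x i) ≤ r).card}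

/-- Twice the `k`-nearest-neighbour distance: the side length of the cell of the `i`-th point. -/
def cellSide {N d : ℕ} (k : ℕ) (x : Fin N → Fin d → ℝ) (i : Fin N) : ℝ :=
  2 * knnDist k x i

/-- The side length in direction `j` of the cell of the `i`-th point after truncation to the unit
cube. -/
def truncSide {N d : ℕ} (k : ℕ) (x : Fin N → Fin d → ℝ) (i : Fin N) (j : Fin d) : ℝ :=
  min (x i j + cellSide k x i / 2) 1 - max (x i j - cellSide k x i / 2) 0

/-- The truncated Kozachenko–Leonenko entropy estimate computed from the sample `x`. -/
def tKL {N d : ℕ} (k : ℕ) (x : Fin N → Fin d → ℝ) : ℝ :=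
  -digamma k + digamma N + 1 / (N : ℝ) * ∑ i, ∑ j, Real.log (truncSide k x i j)

end TruncatedKL

end

/-! Let `r` be the distance from `x i` to its `k`-th neighbour, `V` the volume of the part of that
ball inside the cube and `W` its probability. Truncation makes `∑ j, log ξ` equal to `log V`, and `W
/ V` is the average of `p` over a box inside the cube, so the boundary causes no extra error.

Bias. Given the centre, the mass of the ball through another sample point is uniform on the unit
interval, so `W` is distributed as the `k`-th of `N - 1` uniform order statistics, whatever the
centre and `p` (`IsAdmissibleDensity.map_knnMass`). Hence `E W = k / N`, and `E log W = -(1/k + ...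
+ 1/(N-1)) = ψ(k) - ψ(N)`, which the digamma terms cancel exactly. What is left is `log V - log W +
log p`. Since `p` is `C₂`-Lipschitz and at least `C₁` on the cube, this is at most `C₂ r / C₁` in
absolute value; as `C₁ r ^ d ≤ C₁ V ≤ W`, also `r ≤ (W / C₁) ^ (1/d)`, and Jensen's inequality
finishes.

Variance. In the Efron–Stein inequality `variance_pi_le_of_update` the estimate is compared with the
one in which the `i`-th point is deleted. By a pigeonhole over orthants, deletion changes the
neighbour distances of at most `2 ^ d * k` points, each moving no further than to the next neighbour
distance. Conversely each point is affected by at most `k` deletions, so the squared changes summed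
over `i` are controlled by a sum over all points. Since `log V - log W` is bounded and `log (N W)`
has second moment at most `k + 32`, this sum is `O(N)`; the prefactor `1 / N²` of the estimator
gives `O(1 / N)`. For `N = k + 1` deletion leaves too few neighbours, and a crude bound is absorbed
in the constant. -/

namespace TruncatedKL

/-! ### Deterministic order statistics -/

section OrderStatistics

variable {ι : Type*}

/-- The `k`-th smallest of the numbers `a j`, `j ∈ s`. -/
noncomputable def orderStat (s : Finset ι) (k : ℕ) (a : ι → ℝ) : ℝ :=
  sInf {r : ℝ | k ≤ (s.filter fun j => a j ≤ r).card}

/-- The count only jumps at values `a j`, so the infimum defining `orderStat` is attained, at the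
smallest `a j` that has at least `k` values below or equal to it. This turns comparisons with
`orderStat` into counting. -/
theorem exists_setOf_le_card_eq_Ici {s : Finset ι} {k : ℕ} (hk : 1 ≤ k) (hs : k ≤ s.card)
    (a : ι → ℝ) :
    ∃ j ∈ s, {r : ℝ | k ≤ (s.filter fun j => a j ≤ r).card} = Set.Ici (a j) := by
  classical
  have key : ∀ r : ℝ, k ≤ (s.filter fun j => a j ≤ r).card →
      ∃ j ∈ s, a j ≤ r ∧ k ≤ (s.filter fun l => a l ≤ a j).card := by
    intro r hr
    have hne : (s.filter fun j => a j ≤ r).Nonempty := Finset.card_pos.1 (by omega)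
    obtain ⟨j, hj, hmax⟩ := Finset.exists_max_image _ a hne
    rw [Finset.mem_filter] at hj
    refine ⟨j, hj.1, hj.2, hr.trans (Finset.card_le_card fun l hl => ?_)⟩
    exact Finset.mem_filter.2 ⟨(Finset.mem_filter.1 hl).1, hmax l hl⟩
  have hne : s.Nonempty := Finset.card_pos.1 (by omega)
  obtain ⟨m, -, hm⟩ := Finset.exists_max_image s a hne
  have hall : k ≤ (s.filter fun j => a j ≤ a m).card := by
    rwa [Finset.filter_true_of_mem hm]
  obtain ⟨j₀, hj₀, -, hj₀'⟩ := key _ hall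
  have hne' : (s.filter fun j => k ≤ (s.filter fun l => a l ≤ a j).card).Nonempty :=
    ⟨j₀, Finset.mem_filter.2 ⟨hj₀, hj₀'⟩⟩
  obtain ⟨j, hj, hmin⟩ := Finset.exists_min_image _ a hne'
  rw [Finset.mem_filter] at hj
  refine ⟨j, hj.1, Set.ext fun r => ⟨fun hr => ?_, fun hr => ?_⟩⟩
  · obtain ⟨l, hl, hlr, hl'⟩ := key r hr
    exact (hmin l (Finset.mem_filter.2 ⟨hl, hl'⟩)).trans hlr
  · refine hj.2.trans (Finset.card_le_card fun l hl => ?_)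
    rw [Finset.mem_filter] at hl ⊢
    exact ⟨hl.1, hl.2.trans hr⟩

variable {s t : Finset ι} {k : ℕ} {a : ι → ℝ}

theorem exists_orderStat_eq (hk : 1 ≤ k) (hs : k ≤ s.card) (a : ι → ℝ) :
    ∃ j ∈ s, orderStat s k a = a j := by
  obtain ⟨j, hj, h⟩ := exists_setOf_le_card_eq_Ici hk hs a
  exact ⟨j, hj, by rw [orderStat, h, csInf_Ici]⟩

theorem orderStat_le_iff (hk : 1 ≤ k) (hs : k ≤ s.card) {r : ℝ} :
    orderStat s k a ≤ r ↔ k ≤ (s.filter fun j => a j ≤ r).card := by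
  obtain ⟨j, hj, h⟩ := exists_setOf_le_card_eq_Ici hk hs a
  rw [orderStat, h, csInf_Ici, ← Set.mem_Ici, ← h, Set.mem_ofPred_eq]

theorem le_card_filter_le_orderStat (hk : 1 ≤ k) (hs : k ≤ s.card) (a : ι → ℝ) :
    k ≤ (s.filter fun j => a j ≤ orderStat s k a).card :=
  (orderStat_le_iff hk hs).1 le_rfl

/-- Because the order statistic is attained at some index, `F` needs neither continuity nor
strictness: for `≥`, take the largest `a j` among those whose image is at most the new order
statistic. -/
theorem orderStat_comp_of_monotone (hk : 1 ≤ k) (hs : k ≤ s.card) {F : ℝ → ℝ} (hF : Monotone F)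
    (a : ι → ℝ) : orderStat s k (fun j => F (a j)) = F (orderStat s k a) := by
  apply le_antisymm
  · rw [orderStat_le_iff hk hs]
    refine (le_card_filter_le_orderStat hk hs a).trans (Finset.card_le_card fun l hl => ?_)
    rw [Finset.mem_filter] at hl ⊢
    exact ⟨hl.1, hF hl.2⟩
  · have h := le_card_filter_le_orderStat hk hs fun j => F (a j)
    set t := orderStat s k fun j => F (a j)
    have hne : (s.filter fun j => F (a j) ≤ t).Nonempty := Finset.card_pos.1 (by omega)
    obtain ⟨j, hj, hmax⟩ := Finset.exists_max_image _ a hne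
    refine le_trans (hF ?_) (Finset.mem_filter.1 hj).2
    rw [orderStat_le_iff hk hs]
    refine h.trans (Finset.card_le_card fun l hl => ?_)
    exact Finset.mem_filter.2 ⟨(Finset.mem_filter.1 hl).1, hmax l hl⟩

theorem orderStat_anti_set (hk : 1 ≤ k) (hs : k ≤ s.card) (hst : s ⊆ t) :
    orderStat t k a ≤ orderStat s k a := by
  rw [orderStat_le_iff hk (hs.trans (Finset.card_le_card hst))]
  exact (le_card_filter_le_orderStat hk hs a).trans
    (Finset.card_le_card (Finset.filter_subset_filter _ hst))

/-- Of at least `k + 1` values below a threshold, deleting one index loses at most one. -/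
theorem orderStat_erase_le [DecidableEq ι] (hk : 1 ≤ k) (hs : k + 1 ≤ s.card) (i : ι) :
    orderStat (s.erase i) k a ≤ orderStat s (k + 1) a := by
  have hc : k ≤ (s.erase i).card := by
    have := Finset.pred_card_le_card_erase (s := s) (a := i)
    omega
  rw [orderStat_le_iff hk hc, Finset.filter_erase]
  have h := le_card_filter_le_orderStat (by omega) hs a
  have := Finset.pred_card_le_card_erase (s := s.filter fun j => a j ≤ orderStat s (k + 1) a)
    (a := i)
  omega

theorem measurable_orderStat {α : Type*} [MeasurableSpace α] (hk : 1 ≤ k) (hs : k ≤ s.card)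
    {f : ι → α → ℝ} (hf : ∀ j ∈ s, Measurable (f j)) :
    Measurable fun x => orderStat s k fun j => f j x := by
  refine measurable_of_Iic fun r => ?_
  have : (fun x => orderStat s k fun j => f j x) ⁻¹' Set.Iic r =
      {x | k ≤ (s.filter fun j => f j x ≤ r).card} := by
    ext x
    exact orderStat_le_iff hk hs
  rw [this]
  have : {x | k ≤ (s.filter fun j => f j x ≤ r).card} =
      {x | k ≤ ∑ j ∈ s, Set.indicator {x | f j x ≤ r} (fun _ => (1 : ℕ)) x} := by
    ext x
    simp only [Set.mem_ofPred_eq, Finset.card_filter, Set.indicator_apply]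
  rw [this]
  refine measurableSet_le measurable_const (Finset.measurable_sum _ fun j hj => ?_)
  exact measurable_const.indicator (measurableSet_le (hf j hj) measurable_const)

/-- Deleting an index `i` can only change the `k`-th smallest value if `a i` is at most that value,
and then exactly `k` values are at most it. -/
theorem card_filter_erase_ne_le [DecidableEq ι] (hk : 1 ≤ k) (hs : k + 1 ≤ s.card) (a : ι → ℝ) :
    (s.filter fun i => orderStat (s.erase i) k a ≠ orderStat s k a).card ≤ k := by
  rcases (s.filter fun i => orderStat (s.erase i) k a ≠ orderStat s k a).eq_empty_or_nonempty
    with h | ⟨i₀, hi₀⟩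
  · simp [h]
  -- If deleting `i` moves the order statistic, fewer than `k` of the remaining values are at most
  -- the old one. Since at least `k` were, `i` itself was among them and the count was exactly `k`.
  have key : ∀ i ∈ s, orderStat (s.erase i) k a ≠ orderStat s k a →
      (((s.filter fun j => a j ≤ orderStat s k a)).erase i).card < k := by
    intro i hi h
    have hc : k ≤ (s.erase i).card := by
      rw [Finset.card_erase_of_mem hi]; omega
    have hlt : ¬ orderStat (s.erase i) k a ≤ orderStat s k a := fun hle =>
      h (le_antisymm hle (orderStat_anti_set hk hc (Finset.erase_subset _ _)))
    rw [orderStat_le_iff hk hc, Finset.filter_erase] at hlt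
    omega
  have hsub : (s.filter fun i => orderStat (s.erase i) k a ≠ orderStat s k a) ⊆
      s.filter fun j => a j ≤ orderStat s k a := by
    intro i hi
    rw [Finset.mem_filter] at hi
    by_contra hcon
    have := key i hi.1 hi.2
    rw [Finset.erase_eq_of_notMem hcon] at this
    have := le_card_filter_le_orderStat hk (show k ≤ s.card by omega) a
    omega
  refine (Finset.card_le_card hsub).trans ?_
  have h1 := key i₀ (Finset.mem_filter.1 hi₀).1 (Finset.mem_filter.1 hi₀).2
  rw [Finset.card_erase_of_mem (hsub hi₀)] at h1
  omega

end OrderStatistics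

/-! ### Moments of uniform order statistics -/

section UniformOrderStatistics

theorem integral_pow_mul_one_sub_pow (a b : ℕ) :
    ∫ t in (0 : ℝ)..1, t ^ a * (1 - t) ^ b =
      (a.factorial * b.factorial : ℝ) / (a + b + 1).factorial := by
  induction b generalizing a with
  | zero =>
    simp only [pow_zero, mul_one, integral_pow, Nat.factorial_zero, Nat.cast_one, add_zero,
      Nat.factorial_succ, Nat.cast_mul]
    have := Nat.cast_pos (α := ℝ) |>.2 a.factorial_pos
    field_simp
    simp
  | succ b ih =>
    have hparts := intervalIntegral.integral_mul_deriv_eq_deriv_mul (a := (0 : ℝ)) (b := 1)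
      (u := fun t => (1 - t) ^ (b + 1)) (u' := fun t => -((b + 1 : ℝ) * (1 - t) ^ b))
      (v := fun t => t ^ (a + 1) / (a + 1)) (v' := fun t => t ^ a)
      (fun t _ => by
        have := ((hasDerivAt_id t).const_sub 1).pow (b + 1)
        convert! this using 1
        simp)
      (fun t _ => by
        have := (hasDerivAt_pow (a + 1) t).div_const (a + 1 : ℝ)
        convert! this using 1
        simp
        field_simp)
      (Continuous.intervalIntegrable (by fun_prop) _ _)
      (Continuous.intervalIntegrable (by fun_prop) _ _)
    have h1 : ∫ t in (0 : ℝ)..1, t ^ a * (1 - t) ^ (b + 1) =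
        ∫ t in (0 : ℝ)..1, (1 - t) ^ (b + 1) * t ^ a := by
      congr 1; ext t; ring
    have h2 : ∫ t in (0 : ℝ)..1, -((b + 1 : ℝ) * (1 - t) ^ b) * (t ^ (a + 1) / (a + 1)) =
        ∫ t in (0 : ℝ)..1, -((b + 1 : ℝ) / (a + 1)) * (t ^ (a + 1) * (1 - t) ^ b) := by
      congr 1; ext t; ring
    rw [h1, hparts, h2, intervalIntegral.integral_const_mul, ih (a + 1)]
    have e : a + 1 + b + 1 = a + (b + 1) + 1 := by ring
    rw [e, Nat.factorial_succ a, Nat.factorial_succ b]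
    have h3 := Nat.cast_pos (α := ℝ) |>.2 (a + (b + 1) + 1).factorial_pos
    push_cast
    field_simp
    simp

/-- A binomial probability integrates over its parameter to a value independent of `m`; integrating
a binomial tail thus only counts its terms. -/
theorem choose_mul_integral_pow {n m : ℕ} (hm : m ≤ n) :
    (n.choose m : ℝ) * ∫ t in (0 : ℝ)..1, t ^ m * (1 - t) ^ (n - m) = 1 / (n + 1) := by
  rw [integral_pow_mul_one_sub_pow, Nat.add_sub_cancel' hm, Nat.factorial_succ,
    ← Nat.choose_mul_factorial_mul_factorial hm]
  have h1 := Nat.cast_pos (α := ℝ) |>.2 (Nat.choose_pos hm)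
  have h2 := Nat.cast_pos (α := ℝ) |>.2 m.factorial_pos
  have h3 := Nat.cast_pos (α := ℝ) |>.2 (n - m).factorial_pos
  push_cast
  field_simp

theorem choose_mul_integral_pow_pred {n m : ℕ} (h0 : 1 ≤ m) (hm : m ≤ n) :
    (n.choose m : ℝ) * ∫ t in (0 : ℝ)..1, t ^ (m - 1) * (1 - t) ^ (n - m) = 1 / m := by
  obtain ⟨l, rfl⟩ : ∃ l, m = l + 1 := ⟨m - 1, by omega⟩
  rw [integral_pow_mul_one_sub_pow, show l + 1 - 1 + (n - (l + 1)) + 1 = n by omega,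
    ← Nat.choose_mul_factorial_mul_factorial hm, Nat.factorial_succ]
  have h1 := Nat.cast_pos (α := ℝ) |>.2 (Nat.choose_pos hm)
  have h2 := Nat.cast_pos (α := ℝ) |>.2 l.factorial_pos
  have h3 := Nat.cast_pos (α := ℝ) |>.2 (n - (l + 1)).factorial_pos
  push_cast
  field_simp

open Classical in
/-- The number of hits of `A` among independent samples is binomially distributed. -/
theorem pi_real_le_card_filter {α : Type*} [MeasurableSpace α] {μ : Measure α}
    [IsProbabilityMeasure μ] {A : Set α} (hA : MeasurableSet A) (n k : ℕ) :
    (Measure.pi fun _ : Fin n => μ).real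
        {ω | k ≤ (Finset.univ.filter fun j => ω j ∈ A).card} =
      ∑ m ∈ Finset.Icc k n, (n.choose m : ℝ) * (μ.real A ^ m * (1 - μ.real A) ^ (n - m)) := by
  -- `B S` is the event that exactly the indices in `S` hit `A`. These events are disjoint product
  -- sets whose probability depends only on the size of `S`.
  let B : Finset (Fin n) → Set (Fin n → α) := fun S => Set.univ.pi fun j => if j ∈ S then A else Aᶜ
  have hB : ∀ S ω, ω ∈ B S ↔ (Finset.univ.filter fun j => ω j ∈ A) = S := by
    intro S ω
    simp only [B, Set.mem_univ_pi, Finset.ext_iff, Finset.mem_filter, Finset.mem_univ, true_and]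
    refine forall_congr' fun j => ?_
    by_cases hj : j ∈ S <;> simp [hj]
  have hset : {ω : Fin n → α | k ≤ (Finset.univ.filter fun j => ω j ∈ A).card} =
      ⋃ S ∈ (Finset.univ : Finset (Finset (Fin n))).filter fun S => k ≤ S.card, B S := by
    ext ω
    simp [hB]
  have hBm : ∀ S, MeasurableSet (B S) := fun S =>
    MeasurableSet.univ_pi fun j => by by_cases hj : j ∈ S <;> simp [hj, hA, hA.compl]
  rw [hset, measureReal_biUnion_finset _ fun S _ => hBm S]
  · have hreal : ∀ S : Finset (Fin n), (Measure.pi fun _ : Fin n => μ).real (B S) =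
        μ.real A ^ S.card * (1 - μ.real A) ^ (n - S.card) := by
      intro S
      simp only [B, measureReal_def, Measure.pi_pi, ENNReal.toReal_prod]
      rw [← Finset.prod_mul_prod_compl S,
        Finset.prod_congr rfl (g := fun _ => (μ A).toReal) (fun j hj => by simp [hj]),
        Finset.prod_congr rfl (s₁ := Sᶜ) (g := fun _ => 1 - (μ A).toReal) (fun j hj => by
          rw [if_neg (by simpa using hj)]
          exact probReal_compl_eq_one_sub hA)]
      simp [Finset.card_compl]
    simp_rw [hreal]
    have h := Finset.sum_powerset_apply_card (x := (Finset.univ : Finset (Fin n)))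
      (fun m => if k ≤ m then μ.real A ^ m * (1 - μ.real A) ^ (n - m) else 0)
    rw [Finset.powerset_univ] at h
    rw [Finset.sum_filter, h, Finset.card_fin]
    simp only [nsmul_eq_mul, mul_ite, mul_zero]
    rw [← Finset.sum_filter]
    refine Finset.sum_congr ?_ fun _ _ => rfl
    ext m
    simp only [Finset.mem_filter, Finset.mem_range, Finset.mem_Icc]
    omega
  · intro S _ T _ hST
    refine Set.disjoint_left.2 fun ω h1 h2 => hST ?_
    rw [← (hB S ω).1 h1, (hB T ω).1 h2]

/-- The uniform distribution on the unit interval. -/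
noncomputable def unif : Measure ℝ := volume.restrict (Set.Ioc 0 1)

instance : IsProbabilityMeasure unif := ⟨by simp [unif]⟩

theorem unif_real_Iic {t : ℝ} (h0 : 0 ≤ t) (h1 : t ≤ 1) : unif.real (Set.Iic t) = t := by
  rw [unif, measureReal_restrict_apply measurableSet_Iic, Set.inter_comm, Set.Ioc_inter_Iic,
    min_eq_right h1]
  simp [h0]

/-- The joint distribution of `n` independent uniform random variables. -/
noncomputable abbrev unifPi (n : ℕ) : Measure (Fin n → ℝ) := Measure.pi fun _ => unif

/-- The interval excludes `0`, which makes the order statistics almost surely positive, as their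
logarithms require. -/
theorem ae_unifPi_mem (n : ℕ) : ∀ᵐ u ∂unifPi n, ∀ j, u j ∈ Set.Ioc (0 : ℝ) 1 := by
  rw [ae_all_iff]
  intro j
  have h : ∀ᵐ t ∂unif, t ∈ Set.Ioc (0 : ℝ) 1 := ae_restrict_mem measurableSet_Ioc
  exact (measurePreserving_eval (fun _ : Fin n => unif) j).quasiMeasurePreserving.ae h

variable {n k : ℕ}

theorem measurable_orderStat_univ (hk : 1 ≤ k) (hn : k ≤ n) :
    Measurable fun u : Fin n → ℝ => orderStat Finset.univ k u :=
  measurable_orderStat (f := fun j (u : Fin n → ℝ) => u j) hk (by simpa using hn)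
    fun j _ => measurable_pi_apply j

theorem ae_orderStat_mem (hk : 1 ≤ k) (hn : k ≤ n) :
    ∀ᵐ u ∂unifPi n, orderStat Finset.univ k u ∈ Set.Ioc (0 : ℝ) 1 := by
  filter_upwards [ae_unifPi_mem n] with u hu
  obtain ⟨j, -, hj⟩ := exists_orderStat_eq (s := Finset.univ) hk (by simpa using hn) u
  rw [hj]
  exact hu j

theorem unifPi_real_orderStat_le (hk : 1 ≤ k) (hn : k ≤ n) {t : ℝ} (h0 : 0 ≤ t) (h1 : t ≤ 1) :
    (unifPi n).real {u | orderStat Finset.univ k u ≤ t} =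
      ∑ m ∈ Finset.Icc k n, (n.choose m : ℝ) * (t ^ m * (1 - t) ^ (n - m)) := by
  have h := pi_real_le_card_filter (μ := unif) (measurableSet_Iic (a := t)) n k
  rw [unif_real_Iic h0 h1] at h
  rw [← h]
  congr 1
  ext u
  simp only [Set.mem_ofPred_eq, Set.mem_Iic]
  rw [orderStat_le_iff hk (by simpa using hn)]

theorem integrable_orderStat (hk : 1 ≤ k) (hn : k ≤ n) :
    Integrable (fun u => orderStat Finset.univ k u) (unifPi n) := by
  refine Integrable.of_bound (measurable_orderStat_univ hk hn).aestronglyMeasurable 1 ?_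
  filter_upwards [ae_orderStat_mem hk hn] with u hu
  rw [Real.norm_of_nonneg hu.1.le]
  exact hu.2

/-- Integrate the tail `P(U > t)`: it is `1` minus `n - k + 1` binomial terms, each of integral `1 /
(n + 1)`. -/
theorem integral_orderStat (hk : 1 ≤ k) (hn : k ≤ n) :
    ∫ u, orderStat Finset.univ k u ∂unifPi n = k / (n + 1) := by
  have hmem := ae_orderStat_mem hk hn
  have hmeas := measurable_orderStat_univ hk hn
  rw [(integrable_orderStat hk hn).integral_eq_integral_meas_lt
    (hmem.mono fun u hu => hu.1.le)]
  have h1 : ∀ t ∈ Set.Ioi (0 : ℝ), (unifPi n).real {u | t < orderStat Finset.univ k u} =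
      (Set.Ioc (0 : ℝ) 1).indicator (fun t => 1 - ∑ m ∈ Finset.Icc k n,
        (n.choose m : ℝ) * (t ^ m * (1 - t) ^ (n - m))) t := by
    intro t ht
    by_cases h1 : t ≤ 1
    · rw [Set.indicator_of_mem (show t ∈ Set.Ioc (0 : ℝ) 1 from ⟨ht, h1⟩),
        ← unifPi_real_orderStat_le hk hn (le_of_lt ht) h1,
        ← probReal_compl_eq_one_sub (measurableSet_le hmeas measurable_const)]
      congr 1
      ext u
      simp
    · rw [Set.indicator_of_notMem fun h => h1 h.2, measureReal_def]
      have : unifPi n {u | t < orderStat Finset.univ k u} = 0 := by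
        rw [← MeasureTheory.compl_mem_ae_iff]
        filter_upwards [hmem] with u hu
        simpa using hu.2.trans (not_le.1 h1).le
      rw [this, ENNReal.toReal_zero]
  rw [setIntegral_congr_fun measurableSet_Ioi h1, setIntegral_indicator measurableSet_Ioc,
    Set.inter_eq_right.2 (Set.Ioc_subset_Ioi_self), ← intervalIntegral.integral_of_le zero_le_one,
    intervalIntegral.integral_sub, intervalIntegral.integral_finsetSum]
  · simp_rw [intervalIntegral.integral_const_mul]
    rw [Finset.sum_congr rfl fun m hm => choose_mul_integral_pow (Finset.mem_Icc.1 hm).2]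
    simp only [intervalIntegral.integral_const, sub_zero, smul_eq_mul, mul_one, Finset.sum_const,
      Nat.card_Icc, nsmul_eq_mul]
    rw [Nat.cast_sub (by omega)]
    push_cast
    field_simp
    ring
  · intro m _
    exact Continuous.intervalIntegrable (by fun_prop) _ _
  · exact Continuous.intervalIntegrable (by fun_prop) _ _
  · exact Continuous.intervalIntegrable (by fun_prop) _ _

/-- Write `-log w` as the integral of `1 / t` over `[w, 1]` and apply Tonelli: the binomial term `m`
integrated against `dt / t` gives `1 / m`. In `lintegral` form the identity also yields
integrability. -/
theorem lintegral_neg_log_orderStat (hk : 1 ≤ k) (hn : k ≤ n) :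
    ∫⁻ u, ENNReal.ofReal (-Real.log (orderStat Finset.univ k u)) ∂unifPi n =
      ENNReal.ofReal (∑ m ∈ Finset.Icc k n, 1 / (m : ℝ)) := by
  have hmeas := measurable_orderStat_univ hk hn
  have h1 : ∀ w ∈ Set.Ioc (0 : ℝ) 1, ENNReal.ofReal (-Real.log w) =
      ∫⁻ t in Set.Ioc (0 : ℝ) 1, if w ≤ t then ENNReal.ofReal t⁻¹ else 0 := by
    intro w hw
    have e : (fun t : ℝ => if w ≤ t then ENNReal.ofReal t⁻¹ else 0) =
        (Set.Ici w).indicator fun t => ENNReal.ofReal t⁻¹ := by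
      ext t; simp [Set.indicator_apply]
    have hset : Set.Ioc (0 : ℝ) 1 ∩ Set.Ici w = Set.Icc w 1 := by
      ext t
      simp only [Set.mem_inter_iff, Set.mem_Ioc, Set.mem_Ici, Set.mem_Icc]
      exact ⟨fun h => ⟨h.2, h.1.2⟩, fun h => ⟨⟨hw.1.trans_le h.1, h.2⟩, h.1⟩⟩
    rw [e, lintegral_indicator measurableSet_Ici, Measure.restrict_restrict measurableSet_Ici,
      Set.inter_comm, hset, ← ofReal_integral_eq_lintegral_ofReal]
    · rw [integral_Icc_eq_integral_Ioc, ← intervalIntegral.integral_of_le hw.2,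
        integral_inv_of_pos hw.1 one_pos]
      simp
    · refine ContinuousOn.integrableOn_Icc (continuousOn_id.inv₀ fun t ht => ?_)
      exact (hw.1.trans_le ht.1).ne'
    · filter_upwards [ae_restrict_mem measurableSet_Icc] with t ht
      exact inv_nonneg.2 (hw.1.le.trans ht.1)
  have h2 : ∫⁻ u, ENNReal.ofReal (-Real.log (orderStat Finset.univ k u)) ∂unifPi n =
      ∫⁻ u, (∫⁻ t in Set.Ioc (0 : ℝ) 1, if orderStat Finset.univ k u ≤ t then
        ENNReal.ofReal t⁻¹ else 0) ∂unifPi n := by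
    refine lintegral_congr_ae ?_
    filter_upwards [ae_orderStat_mem hk hn] with u hu using h1 _ hu
  rw [h2, lintegral_lintegral_swap]
  · have h3 : ∀ t ∈ Set.Ioc (0 : ℝ) 1, ∫⁻ u, (if orderStat Finset.univ k u ≤ t then
        ENNReal.ofReal t⁻¹ else 0) ∂unifPi n = ENNReal.ofReal (∑ m ∈ Finset.Icc k n,
        (n.choose m : ℝ) * (t ^ (m - 1) * (1 - t) ^ (n - m))) := by
      intro t ht
      have e : (fun u : Fin n → ℝ => if orderStat Finset.univ k u ≤ t then
          ENNReal.ofReal t⁻¹ else 0) =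
          {u | orderStat Finset.univ k u ≤ t}.indicator fun _ => ENNReal.ofReal t⁻¹ := by
        ext t; simp [Set.indicator_apply]
      rw [e, lintegral_indicator_const (measurableSet_le hmeas measurable_const),
        ← ofReal_measureReal, unifPi_real_orderStat_le hk hn ht.1.le ht.2,
        ← ENNReal.ofReal_mul (inv_nonneg.2 ht.1.le), Finset.mul_sum]
      congr 1
      refine Finset.sum_congr rfl fun m hm => ?_
      obtain ⟨l, rfl⟩ : ∃ l, m = l + 1 := ⟨m - 1, by have := (Finset.mem_Icc.1 hm).1; omega⟩
      have := ht.1.ne'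
      rw [Nat.add_sub_cancel, pow_succ]
      field_simp
    rw [setLIntegral_congr_fun measurableSet_Ioc h3, ← ofReal_integral_eq_lintegral_ofReal]
    · rw [← intervalIntegral.integral_of_le zero_le_one, intervalIntegral.integral_finsetSum]
      · simp_rw [intervalIntegral.integral_const_mul]
        congr 1
        refine Finset.sum_congr rfl fun m hm => ?_
        rw [Finset.mem_Icc] at hm
        exact choose_mul_integral_pow_pred (hk.trans hm.1) hm.2
      · intro m _
        exact Continuous.intervalIntegrable (by fun_prop) _ _
    · exact (Continuous.integrableOn_Ioc (by fun_prop))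
    · filter_upwards [ae_restrict_mem measurableSet_Ioc] with t ht
      have : 0 ≤ 1 - t := sub_nonneg.2 ht.2
      have := ht.1
      exact Finset.sum_nonneg fun m _ => by positivity
  · have hs : MeasurableSet {q : (Fin n → ℝ) × ℝ | orderStat Finset.univ k q.1 ≤ q.2} :=
      measurableSet_le (hmeas.comp measurable_fst) measurable_snd
    exact (Measurable.ite hs (by fun_prop) measurable_const).aemeasurable

theorem integrable_log_orderStat (hk : 1 ≤ k) (hn : k ≤ n) :
    Integrable (fun u => Real.log (orderStat Finset.univ k u)) (unifPi n) := by
  have hmeas := measurable_orderStat_univ hk hn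
  rw [← integrable_neg_iff]
  refine ⟨(Real.measurable_log.comp hmeas).neg.aestronglyMeasurable, ?_⟩
  rw [hasFiniteIntegral_iff_ofReal]
  · have := lintegral_neg_log_orderStat hk hn
    simp only [Pi.neg_apply]
    rw [this]
    exact ENNReal.ofReal_lt_top
  · filter_upwards [ae_orderStat_mem hk hn] with u hu
    simpa using Real.log_nonpos hu.1.le hu.2

theorem integral_log_orderStat (hk : 1 ≤ k) (hn : k ≤ n) :
    ∫ u, Real.log (orderStat Finset.univ k u) ∂unifPi n =
      -∑ m ∈ Finset.Icc k n, 1 / (m : ℝ) := by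
  have hmeas := measurable_orderStat_univ hk hn
  have h : ∫ u, -Real.log (orderStat Finset.univ k u) ∂unifPi n =
      ∑ m ∈ Finset.Icc k n, 1 / (m : ℝ) := by
    rw [integral_eq_lintegral_of_nonneg_ae, lintegral_neg_log_orderStat hk hn,
      ENNReal.toReal_ofReal (Finset.sum_nonneg fun m _ => by positivity)]
    · filter_upwards [ae_orderStat_mem hk hn] with u hu
      simpa using Real.log_nonpos hu.1.le hu.2
    · exact (Real.measurable_log.comp hmeas).neg.aestronglyMeasurable
  rw [← h, integral_neg, neg_neg]

theorem sq_log_le_self {y : ℝ} (hy : 1 ≤ y) : Real.log y ^ 2 ≤ y := by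
  have h0 : 0 < y := by linarith
  have hs : 0 < Real.sqrt y := Real.sqrt_pos.2 h0
  -- With `log z ≤ z - 1` at `z = √y / 2` this gives `log y ≤ √y - 2 + 2 log 2 ≤ √y`.
  have h1 : Real.log y = 2 * Real.log (Real.sqrt y / 2) + 2 * Real.log 2 := by
    rw [Real.log_div hs.ne' two_ne_zero, Real.log_sqrt h0.le]
    ring
  have h2 := Real.log_le_sub_one_of_pos (half_pos hs)
  have h3 := Real.log_two_lt_d9
  have h4 : Real.log y ≤ Real.sqrt y := by rw [h1]; linarith
  have h5 := Real.log_nonneg hy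
  calc Real.log y ^ 2 ≤ Real.sqrt y ^ 2 := by gcongr
    _ = y := Real.sq_sqrt h0.le

theorem sq_log_le_rpow {y : ℝ} (h0 : 0 < y) (hy : y ≤ 1) :
    Real.log y ^ 2 ≤ 16 * y ^ (-(1 / 2) : ℝ) := by
  -- Here `-log y = 4 log z` with `0 ≤ log z ≤ z`, so the square is at most `16 z²`.
  set z := y ^ (-(1 / 4) : ℝ) with hz
  have hz0 : 0 < z := Real.rpow_pos_of_pos h0 _
  have h1 : Real.log z = -(1 / 4) * Real.log y := Real.log_rpow h0 _
  have h2 := Real.log_le_sub_one_of_pos hz0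
  have h3 := Real.log_nonpos h0.le hy
  have h4 : y ^ (-(1 / 2) : ℝ) = z ^ 2 := by
    rw [hz, ← Real.rpow_natCast, ← Real.rpow_mul h0.le]
    norm_num
  rw [h4]
  nlinarith

/-- A dominating function for the lower tail of `log ^ 2`. -/
noncomputable def logTail (c t : ℝ) : ℝ :=
  (Set.Ioc 0 (1 / c)).indicator (fun t => 16 * (c ^ (-(1 / 2) : ℝ) * t ^ (-(1 / 2) : ℝ))) t

theorem logTail_nonneg {c : ℝ} (hc : 0 < c) (t : ℝ) : 0 ≤ logTail c t := by
  refine Set.indicator_nonneg (fun t ht => ?_) t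
  have := ht.1
  positivity

theorem sq_log_mul_le {c t : ℝ} (hc : 0 < c) (ht : 0 < t) :
    Real.log (c * t) ^ 2 ≤ c * t + logTail c t := by
  rcases le_total (c * t) 1 with h | h
  · have h1 : t ∈ Set.Ioc 0 (1 / c) := ⟨ht, by rw [le_div_iff₀ hc]; linarith⟩
    rw [logTail, Set.indicator_of_mem h1, ← Real.mul_rpow hc.le ht.le]
    have := sq_log_le_rpow (mul_pos hc ht) h
    have : 0 < c * t := mul_pos hc ht
    linarith
  · have := sq_log_le_self h
    have := logTail_nonneg hc t
    linarith

theorem integrable_logTail {c : ℝ} (hc : 1 ≤ c) : Integrable (logTail c) unif := by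
  have h1 : IntegrableOn (fun t : ℝ => 16 * (c ^ (-(1 / 2) : ℝ) * t ^ (-(1 / 2) : ℝ)))
      (Set.Ioc 0 (1 / c)) := by
    rw [← intervalIntegrable_iff_integrableOn_Ioc_of_le (by positivity)]
    exact ((intervalIntegral.intervalIntegrable_rpow' (by norm_num)).const_mul _).const_mul _
  exact ((integrable_indicator_iff measurableSet_Ioc).2 h1).restrict

theorem integral_logTail {c : ℝ} (hc : 1 ≤ c) : ∫ t, logTail c t ∂unif = 32 / c := by
  have hc0 : 0 < c := by linarith
  have hsub : Set.Ioc 0 (1 / c) ⊆ Set.Ioc 0 1 :=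
    Set.Ioc_subset_Ioc_right (by rw [div_le_one hc0]; exact hc)
  simp only [logTail, unif]
  rw [setIntegral_indicator measurableSet_Ioc, Set.inter_eq_right.2 hsub,
    ← intervalIntegral.integral_of_le (by positivity), intervalIntegral.integral_const_mul,
    intervalIntegral.integral_const_mul, integral_rpow (Or.inl (by norm_num))]
  have e : (-(1 / 2) + 1 : ℝ) = 1 / 2 := by norm_num
  rw [e, Real.zero_rpow (by norm_num), one_div c, Real.inv_rpow hc0.le, Real.rpow_neg hc0.le]
  have h2 : c ^ (1 / 2 : ℝ) * c ^ (1 / 2 : ℝ) = c := by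
    rw [← Real.rpow_add hc0]; norm_num
  have h3 : 0 < c ^ (1 / 2 : ℝ) := Real.rpow_pos_of_pos hc0 _
  calc _ = 32 / (c ^ (1 / 2 : ℝ) * c ^ (1 / 2 : ℝ)) := by field_simp; ring
    _ = 32 / c := by rw [h2]

/-- The order statistic equals some `u j`, so its lower tail is dominated by the sum of all `n`
tails. The factor `n` is harmless, as each tail has integral `32 / (n + 1)`. -/
theorem sq_log_orderStat_le (hk : 1 ≤ k) (hn : k ≤ n) :
    ∀ᵐ u ∂unifPi n, Real.log ((n + 1) * orderStat Finset.univ k u) ^ 2 ≤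
      (n + 1) * orderStat Finset.univ k u + ∑ j, logTail (n + 1) (u j) := by
  have hc : (0 : ℝ) < n + 1 := by positivity
  filter_upwards [ae_orderStat_mem hk hn] with u hu
  refine (sq_log_mul_le hc hu.1).trans (add_le_add le_rfl ?_)
  obtain ⟨j, -, hj⟩ := exists_orderStat_eq (s := Finset.univ) hk (by simpa using hn) u
  rw [hj]
  exact Finset.single_le_sum (f := fun j => logTail (n + 1) (u j))
    (fun i _ => logTail_nonneg hc (u i)) (Finset.mem_univ j)

theorem integrable_logTail_apply (j : Fin n) :
    Integrable (fun u : Fin n → ℝ => logTail (n + 1) (u j)) (unifPi n) :=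
  (measurePreserving_eval (fun _ : Fin n => unif) j).integrable_comp_of_integrable
    (integrable_logTail (by linarith [(Nat.cast_nonneg n : (0 : ℝ) ≤ n)]))

theorem integrable_sq_log_orderStat (hk : 1 ≤ k) (hn : k ≤ n) :
    Integrable (fun u => Real.log ((n + 1) * orderStat Finset.univ k u) ^ 2) (unifPi n) := by
  have hmeas := measurable_orderStat_univ hk hn
  refine Integrable.mono' (((integrable_orderStat hk hn).const_mul (n + 1 : ℝ)).add
    (integrable_finsetSum Finset.univ fun j _ => integrable_logTail_apply j))
    ((Real.measurable_log.comp (hmeas.const_mul _)).pow_const 2).aestronglyMeasurable ?_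
  filter_upwards [sq_log_orderStat_le hk hn] with u hu
  rw [Real.norm_of_nonneg (sq_nonneg _)]
  exact hu

theorem integral_sq_log_orderStat_le (hk : 1 ≤ k) (hn : k ≤ n) :
    ∫ u, Real.log ((n + 1) * orderStat Finset.univ k u) ^ 2 ∂unifPi n ≤ k + 32 := by
  have h1 : Integrable (fun u => ((n : ℝ) + 1) * orderStat Finset.univ k u) (unifPi n) :=
    (integrable_orderStat hk hn).const_mul (n + 1 : ℝ)
  have h2 := integrable_finsetSum Finset.univ fun j _ => integrable_logTail_apply (n := n) j
  refine (integral_mono_ae (integrable_sq_log_orderStat hk hn) (h1.add h2)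
    (sq_log_orderStat_le hk hn)).trans ?_
  simp only [Pi.add_apply]
  rw [integral_add h1 h2, integral_const_mul, integral_orderStat hk hn,
    integral_finsetSum _ fun j _ => integrable_logTail_apply j]
  have h3 : ∀ j : Fin n, ∫ u, logTail (n + 1) (u j) ∂unifPi n = 32 / (n + 1) := by
    intro j
    have hc : (1 : ℝ) ≤ n + 1 := by linarith [(Nat.cast_nonneg n : (0 : ℝ) ≤ n)]
    have hp := measurePreserving_eval (fun _ : Fin n => unif) j
    have hm : AEStronglyMeasurable (logTail (n + 1))
        (Measure.map (Function.eval j) (unifPi n)) := by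
      rw [hp.map_eq]; exact (integrable_logTail hc).aestronglyMeasurable
    rw [← integral_logTail hc, ← integral_map hp.measurable.aemeasurable hm, hp.map_eq]
  simp_rw [h3]
  have hn0 : (0 : ℝ) < n + 1 := by positivity
  simp only [Finset.sum_const, Finset.card_univ, Fintype.card_fin, nsmul_eq_mul]
  rw [mul_div_cancel₀ _ hn0.ne']
  have : (n : ℝ) * (32 / (n + 1)) ≤ 32 := by
    rw [mul_div_assoc', div_le_iff₀ hn0]; linarith
  linarith

end UniformOrderStatistics

/-! ### Probability integral transform -/

section ProbabilityIntegralTransform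

theorem continuous_cdf (ν : Measure ℝ) [IsProbabilityMeasure ν] [NullSingletonClass ν] :
    Continuous (cdf ν) := by
  rw [continuous_iff_continuousAt]
  intro x
  rw [(monotone_cdf ν).continuousAt_iff_leftLim_eq_rightLim]
  have h1 : Function.rightLim (cdf ν) x = cdf ν x := (cdf ν).rightLim_eq x
  have h2 := (cdf ν).measure_singleton x
  rw [measure_cdf, measure_singleton] at h2
  have h3 := ENNReal.ofReal_eq_zero.1 h2.symm
  have h4 := (monotone_cdf ν).leftLim_le (le_refl x)
  rw [h1]
  linarith

/-- The cumulative distribution function of an atomless distribution pushes it forward to the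
uniform distribution. -/
theorem map_cdf_eq_unif (ν : Measure ℝ) [IsProbabilityMeasure ν] [NullSingletonClass ν] :
    ν.map (cdf ν) = unif := by
  have hcont := continuous_cdf ν
  have hmono := monotone_cdf ν
  have : IsProbabilityMeasure (ν.map (cdf ν)) :=
    Measure.isProbabilityMeasure_map hcont.measurable.aemeasurable
  refine Measure.ext_of_Iic _ _ fun t => ?_
  rw [Measure.map_apply hcont.measurable measurableSet_Iic]
  -- For `t < 1` this closed sublevel set is empty or a half-line ending at `sSup A`. There the cdf
  -- equals `t`: were it smaller, continuity would put points to the right of `sSup A` into `A`.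
  set A := cdf ν ⁻¹' Set.Iic t with hA
  have hAc : IsClosed A := isClosed_Iic.preimage hcont
  rcases lt_or_ge t 1 with ht1 | ht1
  swap
  · have : A = Set.univ := Set.eq_univ_of_forall fun r => (cdf_le_one ν r).trans ht1
    rw [this, measure_univ, unif, Measure.restrict_apply measurableSet_Iic,
      Set.inter_eq_right.2 fun r hr => hr.2.trans ht1]
    simp
  rcases A.eq_empty_or_nonempty with hemp | hne
  · have ht : t ≤ 0 := by
      by_contra! h
      obtain ⟨r, hr⟩ := ((tendsto_cdf_atBot ν).eventually (gt_mem_nhds h)).exists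
      exact (hemp ▸ (show r ∈ A from hr.le) : r ∈ (∅ : Set ℝ))
    rw [hemp, measure_empty, unif, Measure.restrict_apply measurableSet_Iic]
    have : Set.Iic t ∩ Set.Ioc 0 1 = ∅ := by
      ext r
      simp only [Set.mem_inter_iff, Set.mem_Iic, Set.mem_Ioc, Set.mem_empty_iff_false, iff_false]
      intro h
      linarith [h.1, h.2.1]
    rw [this, measure_empty]
  · have ht0 : 0 ≤ t := hne.elim fun r hr => (cdf_nonneg ν r).trans hr
    obtain ⟨R, hR⟩ := ((tendsto_cdf_atTop ν).eventually (lt_mem_nhds ht1)).exists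
    have hbdd : BddAbove A := ⟨R, fun r hr => by
      by_contra! h
      exact absurd (hmono h.le) (not_le.2 (lt_of_le_of_lt hr hR))⟩
    have hm := hAc.csSup_mem hne hbdd
    have hAI : A = Set.Iic (sSup A) := Set.ext fun r =>
      ⟨fun hr => le_csSup hbdd hr, fun hr => (hmono hr).trans hm⟩
    have hFm : cdf ν (sSup A) = t := by
      refine le_antisymm hm ?_
      by_contra! h
      obtain ⟨r, hr, hrm⟩ := ((((hcont.tendsto (sSup A)).eventually (gt_mem_nhds h)).filter_mono
        nhdsWithin_le_nhds).and (self_mem_nhdsWithin (s := Set.Ioi (sSup A)))).exists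
      exact absurd (le_csSup hbdd (show r ∈ A from hr.le)) (not_le.2 hrm)
    rw [hAI, ← ofReal_cdf, hFm, ← ofReal_measureReal, unif_real_Iic ht0 ht1.le]

end ProbabilityIntegralTransform

/-! ### Bounds and Lipschitz continuity of the density -/

section Density

variable {d : ℕ} {p : (Fin d → ℝ) → ℝ} {C₁ C₂ : ℝ}

theorem isCompact_unitCube (d : ℕ) : IsCompact (unitCube d) := isCompact_Icc

theorem measurableSet_unitCube (d : ℕ) : MeasurableSet (unitCube d) :=
  (isCompact_unitCube d).isClosed.measurableSet

theorem convex_unitCube (d : ℕ) : Convex ℝ (unitCube d) := convex_Icc 0 1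

theorem interior_unitCube (d : ℕ) :
    interior (unitCube d) = Set.univ.pi fun _ => Set.Ioo (0 : ℝ) 1 := by
  rw [unitCube, ← Set.pi_univ_Icc, interior_pi_set Set.finite_univ]
  simp

theorem closure_interior_unitCube (d : ℕ) : closure (interior (unitCube d)) = unitCube d := by
  rw [interior_unitCube, closure_pi_set, unitCube, ← Set.pi_univ_Icc]
  simp

theorem interior_unitCube_nonempty (d : ℕ) : (interior (unitCube d)).Nonempty := by
  rw [interior_unitCube]
  exact ⟨fun _ => 1 / 2, fun _ _ => by norm_num⟩

namespace IsAdmissibleDensity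

variable (hp : IsAdmissibleDensity p C₁ C₂)
include hp

theorem le_apply {x : Fin d → ℝ} (hx : x ∈ unitCube d) : C₁ ≤ p x :=
  hp.isGLB.1 (Set.mem_image_of_mem p hx)

theorem apply_eq_zero {x : Fin d → ℝ} (hx : x ∉ unitCube d) : p x = 0 :=
  Function.notMem_support.1 fun h => hx (hp.support_subset h)

theorem nonneg (x : Fin d → ℝ) : 0 ≤ p x := by
  by_cases hx : x ∈ unitCube d
  · exact hp.pos.le.trans (hp.le_apply hx)
  · rw [hp.apply_eq_zero hx]

theorem exists_forall_le : ∃ C : ℝ, 0 < C ∧ ∀ x, p x ≤ C := by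
  obtain ⟨C, hC⟩ := (isCompact_unitCube d).bddAbove_image hp.continuousOn
  have h0 : (0 : Fin d → ℝ) ∈ unitCube d := Set.left_mem_Icc.2 zero_le_one
  have hC0 : 0 < C := (hp.pos.trans_le (hp.le_apply h0)).trans_le (hC ⟨_, h0, rfl⟩)
  refine ⟨C, hC0, fun x => ?_⟩
  by_cases hx : x ∈ unitCube d
  · exact hC ⟨_, hx, rfl⟩
  · rw [hp.apply_eq_zero hx]
    exact hC0.le

theorem measurable : Measurable p := by
  classical
  have h : p = (unitCube d).piecewise p 0 := by
    ext x
    by_cases hx : x ∈ unitCube d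
    · simp [hx]
    · simp [hx, hp.apply_eq_zero hx]
  rw [h]
  exact hp.continuousOn.measurable_piecewise continuousOn_const (measurableSet_unitCube d)

theorem integrable : Integrable p := by
  -- A non-integrable function has integral `0` by default, contradicting total mass `1`.
  by_contra h
  have := hp.integral_eq_one
  rw [integral_undef h] at this
  exact zero_ne_one this

theorem isProbabilityMeasure_law : IsProbabilityMeasure (law p) := by
  refine ⟨?_⟩
  rw [law, withDensity_apply _ MeasurableSet.univ, Measure.restrict_univ,
    ← ofReal_integral_eq_lintegral_ofReal hp.integrable
    (Filter.Eventually.of_forall hp.nonneg), hp.integral_eq_one, ENNReal.ofReal_one]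

theorem law_real_apply {s : Set (Fin d → ℝ)} (hs : MeasurableSet s) :
    (law p).real s = ∫ x in s ∩ unitCube d, p x := by
  rw [measureReal_def, law, withDensity_apply _ hs,
    ← ofReal_integral_eq_lintegral_ofReal hp.integrable.restrict
    (Filter.Eventually.of_forall hp.nonneg),
    ENNReal.toReal_ofReal (integral_nonneg hp.nonneg)]
  refine (setIntegral_eq_of_subset_of_forall_sdiff_eq_zero hs Set.inter_subset_left
    fun x hx => hp.apply_eq_zero fun h => hx.2 ⟨hx.1, h⟩)

theorem ae_mem_unitCube : ∀ᵐ x ∂law p, x ∈ unitCube d := by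
  have := hp.isProbabilityMeasure_law
  rw [ae_iff]
  have h := hp.law_real_apply (measurableSet_unitCube d).compl
  rw [Set.compl_inter_self, setIntegral_empty, measureReal_eq_zero_iff] at h
  exact h

theorem integral_law (f : (Fin d → ℝ) → ℝ) : ∫ x, f x ∂law p = ∫ x, f x * p x := by
  rw [law, integral_withDensity_eq_integral_toReal_smul
    (hp.measurable.ennreal_ofReal) (Filter.Eventually.of_forall fun _ => ENNReal.ofReal_lt_top)]
  refine integral_congr_ae (Filter.Eventually.of_forall fun x => ?_)
  simp only [smul_eq_mul]
  rw [ENNReal.toReal_ofReal (hp.nonneg x), mul_comm]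

theorem gradL1_le {x : Fin d → ℝ} (hx : x ∈ interior (unitCube d)) : gradL1 p x ≤ C₂ :=
  hp.isLUB.1 (Set.mem_image_of_mem _ hx)

theorem lipschitz_const_nonneg : 0 ≤ C₂ := by
  obtain ⟨x, hx⟩ := interior_unitCube_nonempty d
  exact (Finset.sum_nonneg fun _ _ => abs_nonneg _).trans (hp.gradL1_le hx)

omit hp in
-- The `ℓ¹`-norm is dual to the maximum norm, in which the balls are taken; so `C₂` is the matching
-- Lipschitz constant.
theorem norm_fderiv_le_gradL1 (x : Fin d → ℝ) : ‖fderiv ℝ p x‖ ≤ gradL1 p x := by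
  refine ContinuousLinearMap.opNorm_le_bound _ (Finset.sum_nonneg fun _ _ => abs_nonneg _)
    fun v => ?_
  have hv : v = ∑ j, v j • (Pi.single j 1 : Fin d → ℝ) := by
    ext l
    simp [Finset.sum_apply, Pi.single_apply]
  conv_lhs => rw [hv]
  rw [map_sum, gradL1, Finset.sum_mul]
  refine (norm_sum_le _ _).trans (Finset.sum_le_sum fun j _ => ?_)
  rw [map_smul, norm_smul, Real.norm_eq_abs (fderiv ℝ p x _), mul_comm]
  exact mul_le_mul_of_nonneg_left (norm_le_pi_norm v j) (abs_nonneg _)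

/-- The mean value inequality applies on the convex interior; continuity carries the bound to the
closed cube. -/
theorem lipschitzOnWith : LipschitzOnWith (Real.toNNReal C₂) p (unitCube d) := by
  have h : LipschitzOnWith (Real.toNNReal C₂) p (interior (unitCube d)) := by
    refine (convex_unitCube d).interior.lipschitzOnWith_of_nnnorm_fderiv_le
      (fun x hx => hp.differentiableOn.differentiableAt (isOpen_interior.mem_nhds hx))
      fun x hx => ?_
    rw [← NNReal.coe_le_coe, Real.coe_toNNReal _ hp.lipschitz_const_nonneg]
    exact (norm_fderiv_le_gradL1 x).trans (hp.gradL1_le hx)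
  rw [← closure_interior_unitCube d]
  refine h.closure ?_
  rw [closure_interior_unitCube d]
  exact hp.continuousOn

theorem abs_sub_le {x y : Fin d → ℝ} (hx : x ∈ unitCube d) (hy : y ∈ unitCube d) :
    |p y - p x| ≤ C₂ * dist y x := by
  have h := hp.lipschitzOnWith.dist_le_mul y hy x hx
  rwa [Real.coe_toNNReal _ hp.lipschitz_const_nonneg, Real.dist_eq] at h

end IsAdmissibleDensity

end Density

/-! ### Truncated balls: volume and probability -/

section Box

variable {d : ℕ} {p : (Fin d → ℝ) → ℝ} {C₁ C₂ : ℝ}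

/-- The `j`-th side length of the intersection of the unit cube with the closed ball around `x` of
radius `r` in the maximum norm. -/
noncomputable def boxSide (x : Fin d → ℝ) (r : ℝ) (j : Fin d) : ℝ :=
  min (x j + r) 1 - max (x j - r) 0

theorem truncSide_eq_boxSide {N k : ℕ} (x : Fin N → Fin d → ℝ) (i : Fin N) (j : Fin d) :
    truncSide k x i j = boxSide (x i) (knnDist k x i) j := by
  simp [truncSide, cellSide, boxSide]

variable {x : Fin d → ℝ} {r : ℝ}

theorem mem_unitCube_iff : x ∈ unitCube d ↔ ∀ j, 0 ≤ x j ∧ x j ≤ 1 := by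
  simp [unitCube, Set.mem_Icc, Pi.le_def, forall_and]

theorem boxSide_mono {s : ℝ} (hrs : r ≤ s) (j : Fin d) : boxSide x r j ≤ boxSide x s j := by
  unfold boxSide
  gcongr

theorem boxSide_nonneg (hx : x ∈ unitCube d) (hr : 0 ≤ r) (j : Fin d) : 0 ≤ boxSide x r j := by
  have := mem_unitCube_iff.1 hx j
  unfold boxSide
  grind

theorem boxSide_pos (hx : x ∈ unitCube d) (hr : 0 < r) (j : Fin d) : 0 < boxSide x r j := by
  have := mem_unitCube_iff.1 hx j
  unfold boxSide
  grind

/-- If both ends are cut off the side is `1`; otherwise a full half of length `r` survives. -/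
theorem le_boxSide (hx : x ∈ unitCube d) (hr0 : 0 ≤ r) (hr : r ≤ 1) (j : Fin d) : r ≤ boxSide x r j := by
  have := mem_unitCube_iff.1 hx j
  unfold boxSide
  grind

theorem closedBall_inter_unitCube (hr : 0 ≤ r) :
    Metric.closedBall x r ∩ unitCube d =
      Set.Icc (fun j => max (x j - r) 0) (fun j => min (x j + r) 1) := by
  rw [unitCube, closedBall_pi x hr]
  ext y
  simp only [Set.mem_inter_iff, Set.mem_univ_pi, Metric.mem_closedBall, Real.dist_eq, abs_le,
    Set.mem_Icc, Pi.le_def, Pi.zero_apply, Pi.one_apply, max_le_iff, le_min_iff, ← forall_and]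
  refine forall_congr' fun j => ?_
  constructor
  · rintro ⟨⟨h1, h2⟩, h3, h4⟩
    exact ⟨⟨by linarith, h3⟩, by linarith, h4⟩
  · rintro ⟨⟨h1, h3⟩, h2, h4⟩
    exact ⟨⟨by linarith, by linarith⟩, h3, h4⟩

theorem volume_real_box (hx : x ∈ unitCube d) (hr : 0 ≤ r) :
    volume.real (Metric.closedBall x r ∩ unitCube d) = ∏ j, boxSide x r j := by
  rw [closedBall_inter_unitCube hr, measureReal_def, Real.volume_Icc_pi_toReal]
  · rfl
  · intro j
    have := boxSide_nonneg hx hr j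
    rw [boxSide] at this
    linarith

/-- The probability of the closed ball around `y` of radius `r`. -/
noncomputable def ballMass (p : (Fin d → ℝ) → ℝ) (y : Fin d → ℝ) (r : ℝ) : ℝ :=
  (law p).real (Metric.closedBall y r)

theorem abs_setIntegral_sub_le {s : Set (Fin d → ℝ)}
    (hfin : volume s ≠ ⊤) (hint : IntegrableOn p s) {c K : ℝ} (h : ∀ y ∈ s, |p y - c| ≤ K) :
    |(∫ y in s, p y) - c * volume.real s| ≤ K * volume.real s := by
  have h1 : (∫ y in s, p y) - c * volume.real s = ∫ y in s, (p y - c) := by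
    rw [integral_sub hint (integrableOn_const hfin), setIntegral_const, smul_eq_mul, mul_comm]
  rw [h1, ← Real.norm_eq_abs]
  exact norm_setIntegral_le_of_norm_le_const hfin.lt_top h

namespace IsAdmissibleDensity

variable (hp : IsAdmissibleDensity p C₁ C₂)
include hp

theorem ballMass_eq_setIntegral (y : Fin d → ℝ) (r : ℝ) :
    ballMass p y r = ∫ z in Metric.closedBall y r ∩ unitCube d, p z :=
  hp.law_real_apply Metric.isClosed_closedBall.measurableSet

omit hp in
theorem measurableSet_box : MeasurableSet (Metric.closedBall x r ∩ unitCube d) :=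
  Metric.isClosed_closedBall.measurableSet.inter (measurableSet_unitCube d)

omit hp in
theorem volume_box_ne_top : volume (Metric.closedBall x r ∩ unitCube d) ≠ ⊤ :=
  ne_top_of_le_ne_top (isCompact_unitCube d).measure_ne_top (measure_mono Set.inter_subset_right)

/-- The ball has no mass outside the cube, and inside both `p` deviates from `p x` by at most `C₂
r`. Comparing with the truncated volume keeps this valid near the boundary. -/
theorem abs_ballMass_sub_le (hx : x ∈ unitCube d) (hr : 0 ≤ r) :
    |ballMass p x r - p x * ∏ j, boxSide x r j| ≤ C₂ * r * ∏ j, boxSide x r j := by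
  rw [hp.ballMass_eq_setIntegral, ← volume_real_box hx hr]
  refine abs_setIntegral_sub_le volume_box_ne_top hp.integrable.integrableOn
    fun y hy => (hp.abs_sub_le hx hy.2).trans ?_
  exact mul_le_mul_of_nonneg_left hy.1 hp.lipschitz_const_nonneg

theorem le_ballMass (hx : x ∈ unitCube d) (hr : 0 ≤ r) :
    C₁ * ∏ j, boxSide x r j ≤ ballMass p x r := by
  rw [hp.ballMass_eq_setIntegral, ← volume_real_box hx hr]
  have h := setIntegral_mono_on (integrableOn_const volume_box_ne_top) hp.integrable.integrableOn
    (measurableSet_box (x := x) (r := r)) fun y hy => hp.le_apply hy.2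
  rwa [setIntegral_const, smul_eq_mul, mul_comm] at h

theorem ballMass_le (hx : x ∈ unitCube d) (hr : 0 ≤ r) {C : ℝ} (hC : ∀ x, p x ≤ C) :
    ballMass p x r ≤ C * ∏ j, boxSide x r j := by
  rw [hp.ballMass_eq_setIntegral, ← volume_real_box hx hr]
  have h := setIntegral_mono_on hp.integrable.integrableOn (integrableOn_const volume_box_ne_top)
    (measurableSet_box (x := x) (r := r)) fun y _ => hC y
  rwa [setIntegral_const, smul_eq_mul, mul_comm] at h

theorem ballMass_mono (y : Fin d → ℝ) : Monotone (ballMass p y) := by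
  have := hp.isProbabilityMeasure_law
  exact fun r s h => measureReal_mono (Metric.closedBall_subset_closedBall h)

theorem measurable_ballMass : Measurable fun q : (Fin d → ℝ) × ℝ => ballMass p q.1 q.2 := by
  have := hp.isProbabilityMeasure_law
  have hs : MeasurableSet {w : ((Fin d → ℝ) × ℝ) × (Fin d → ℝ) | dist w.2 w.1.1 ≤ w.1.2} :=
    measurableSet_le (by fun_prop) (by fun_prop)
  exact (measurable_measure_prodMk_left (ν := law p) hs).ennreal_toReal

/-- The probability of the ball around `y` through a random point is uniformly distributed. -/
theorem measurePreserving_ballMass_dist (hd : 1 ≤ d) (y : Fin d → ℝ) :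
    MeasurePreserving (fun z => ballMass p y (dist z y)) (law p) unif := by
  have := hp.isProbabilityMeasure_law
  have : Nonempty (Fin d) := ⟨⟨0, hd⟩⟩
  have hdist : Measurable fun z : Fin d → ℝ => dist z y := by fun_prop
  set ν := (law p).map fun z => dist z y
  have : IsProbabilityMeasure ν := Measure.isProbabilityMeasure_map hdist.aemeasurable
  -- Spheres are Lebesgue null, so the distance to `y` has an atomless law. This uses `d ≥ 1`.
  have hatoms : NullSingletonClass ν := by
    refine ⟨fun r => ?_⟩
    rw [Measure.map_apply hdist (measurableSet_singleton r)]
    have h0 : volume (Metric.sphere y r) = 0 := Measure.addHaar_sphere _ y r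
    exact (withDensity_absolutelyContinuous _ _) h0
  have hcdf : ∀ r, ballMass p y r = cdf ν r := by
    intro r
    rw [cdf_eq_real, measureReal_def, Measure.map_apply hdist measurableSet_Iic]
    rfl
  have hpair : Measurable fun z => (y, dist z y) := measurable_const.prodMk hdist
  have hm : Measurable fun z => ballMass p y (dist z y) := by
    have h := hp.measurable_ballMass.comp hpair
    exact h
  refine ⟨hm, ?_⟩
  simp_rw [hcdf]
  rw [← map_cdf_eq_unif ν, Measure.map_map (continuous_cdf ν).measurable hdist]
  rfl

end IsAdmissibleDensity

end Box

/-! ### Distribution of the nearest-neighbour mass -/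

section NearestNeighbour

variable {d : ℕ} {p : (Fin d → ℝ) → ℝ} {C₁ C₂ : ℝ} {n N k : ℕ}

theorem knnDist_eq_orderStat (k : ℕ) (x : Fin N → Fin d → ℝ) (i : Fin N) :
    knnDist k x i = orderStat (Finset.univ.erase i) k fun j => dist (x j) (x i) := by
  unfold knnDist orderStat
  congr! 5 with r
  ext j
  simp

theorem card_univ_erase_fin (i : Fin N) : (Finset.univ.erase i).card = N - 1 := by
  rw [Finset.card_erase_of_mem (Finset.mem_univ i), Finset.card_fin]

theorem knnDist_eq_orderStat_succAbove (k : ℕ) (x : Fin (n + 1) → Fin d → ℝ) (i : Fin (n + 1)) :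
    knnDist k x i = orderStat Finset.univ k fun j => dist (x (i.succAbove j)) (x i) := by
  have h : Finset.univ.erase i = Finset.univ.map (Fin.succAboveEmb i) := by
    ext j
    simp only [Finset.mem_erase, Finset.mem_univ, and_true, Finset.mem_map, true_and,
      Fin.coe_succAboveEmb]
    exact Fin.exists_succAbove_eq_iff.symm
  rw [knnDist_eq_orderStat, h]
  unfold orderStat
  congr! 3 with r
  rw [Finset.filter_map, Finset.card_map]
  rfl

theorem measurable_knnDist (hk : 1 ≤ k) (hN : k < N) (i : Fin N) :
    Measurable fun x : Fin N → Fin d → ℝ => knnDist k x i := by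
  simp_rw [knnDist_eq_orderStat]
  refine measurable_orderStat hk (by rw [card_univ_erase_fin]; omega) fun j _ => ?_
  exact (measurable_pi_apply j).dist (measurable_pi_apply i)

/-- The probability of the ball around the `i`-th point through its `k`-th nearest neighbour. -/
noncomputable def knnMass (p : (Fin d → ℝ) → ℝ) (k : ℕ) (x : Fin N → Fin d → ℝ) (i : Fin N) : ℝ :=
  ballMass p (x i) (knnDist k x i)

variable (hp : IsAdmissibleDensity p C₁ C₂)
include hp

theorem IsAdmissibleDensity.measurable_knnMass (hk : 1 ≤ k) (hN : k < N) (i : Fin N) :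
    Measurable fun x : Fin N → Fin d → ℝ => knnMass p k x i := by
  have hpair : Measurable fun x : Fin N → Fin d → ℝ => (x i, knnDist k x i) :=
    (measurable_pi_apply i).prodMk (measurable_knnDist hk hN i)
  have h := hp.measurable_ballMass.comp hpair
  exact h

/-- The mass of the nearest neighbour ball is distributed as a uniform order statistic. -/
theorem IsAdmissibleDensity.map_knnMass (hd : 1 ≤ d) (hk : 1 ≤ k) (hn : k ≤ n) (i : Fin (n + 1)) :
    (Measure.pi fun _ : Fin (n + 1) => law p).map (fun x => knnMass p k x i) =
      (unifPi n).map fun u => orderStat Finset.univ k u := by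
  have := hp.isProbabilityMeasure_law
  have hcard : k ≤ (Finset.univ : Finset (Fin n)).card := by simpa using hn
  let G : (Fin d → ℝ) × (Fin n → Fin d → ℝ) → ℝ := fun q =>
    ballMass p q.1 (orderStat Finset.univ k fun j => dist (q.2 j) q.1)
  have hG : Measurable G := by
    have h1 := measurable_orderStat
      (f := fun j (q : (Fin d → ℝ) × (Fin n → Fin d → ℝ)) => dist (q.2 j) q.1) hk hcard
      fun j _ => ((measurable_pi_apply j).comp measurable_snd).dist measurable_fst
    have h2 := hp.measurable_ballMass.comp (measurable_fst.prodMk h1)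
    exact h2
  have he := measurePreserving_piFinSuccAbove (fun _ : Fin (n + 1) => law p) i
  have hW : (fun x => knnMass p k x i) =
      G ∘ MeasurableEquiv.piFinSuccAbove (fun _ : Fin (n + 1) => Fin d → ℝ) i := by
    ext x
    simp only [knnMass, knnDist_eq_orderStat_succAbove, G, Function.comp_apply]
    rfl
  rw [hW, ← Measure.map_map hG he.measurable, he.map_eq]
  ext A hA
  rw [Measure.map_apply hG hA, Measure.prod_apply (hG hA),
    Measure.map_apply (measurable_orderStat_univ hk hn) hA]
  -- For a fixed centre `y` the ball masses of the other points are i.i.d. uniform, and the monotone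
  -- `ballMass p y` commutes with the order statistic. The conditional law does not depend on `y`,
  -- so averaging over the centre is trivial.
  have hin : ∀ y : Fin d → ℝ, (Measure.pi fun _ : Fin n => law p) (Prod.mk y ⁻¹' (G ⁻¹' A)) =
      unifPi n ((fun u => orderStat Finset.univ k u) ⁻¹' A) := by
    intro y
    have hT : MeasurePreserving (fun (z : Fin n → Fin d → ℝ) j => ballMass p y (dist (z j) y))
        (Measure.pi fun _ : Fin n => law p) (unifPi n) :=
      measurePreserving_pi (fun _ : Fin n => law p) (fun _ => unif)
        (f := fun _ z => ballMass p y (dist z y)) fun _ => hp.measurePreserving_ballMass_dist hd y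
    rw [← hT.measure_preimage ((measurable_orderStat_univ hk hn) hA).nullMeasurableSet]
    congr 1
    ext z
    simp only [Set.mem_preimage, G]
    rw [orderStat_comp_of_monotone hk hcard (hp.ballMass_mono y)]
  simp_rw [hin]
  rw [lintegral_const, measure_univ, mul_one]

end NearestNeighbour

/-! ### An Efron–Stein inequality -/

section EfronStein

variable {ι E : Type*} [MeasurableSpace E]

open Classical in
/-- Exchange the two components of the pairs with index in `S`. -/
noncomputable def swapOn (S : Set ι) (ω : ι → E × E) : ι → E × E :=
  fun j => if j ∈ S then (ω j).swap else ω j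

open Classical in
theorem measurePreserving_swapOn [Fintype ι] (μ : Measure E) [IsProbabilityMeasure μ] (S : Set ι) :
    MeasurePreserving (swapOn S) (Measure.pi fun _ : ι => μ.prod μ)
      (Measure.pi fun _ : ι => μ.prod μ) := by
  have h : ∀ j : ι, MeasurePreserving (fun q : E × E => if j ∈ S then q.swap else q)
      (μ.prod μ) (μ.prod μ) := by
    intro j
    by_cases hj : j ∈ S
    · simpa [hj] using! Measure.measurePreserving_swap (μ := μ) (ν := μ)
    · simpa [hj] using! MeasurePreserving.id (μ.prod μ)
  exact measurePreserving_pi (fun _ : ι => μ.prod μ) (fun _ : ι => μ.prod μ) h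

theorem measurePreserving_fst_pi [Fintype ι] (μ : Measure E) [IsProbabilityMeasure μ] :
    MeasurePreserving (fun (ω : ι → E × E) j => (ω j).1) (Measure.pi fun _ : ι => μ.prod μ)
      (Measure.pi fun _ : ι => μ) :=
  measurePreserving_pi (fun _ : ι => μ.prod μ) (fun _ : ι => μ)
    (f := fun _ => Prod.fst) fun _ => measurePreserving_fst

open Classical in
/-- A form of the Efron–Stein inequality: the variance of a function of independent variables is
controlled by its distances to functions that do not depend on one of the variables. -/
theorem variance_pi_le_of_update {n : ℕ} (μ : Measure E) [IsProbabilityMeasure μ]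
    {f : (Fin n → E) → ℝ} (hf : MemLp f 2 (Measure.pi fun _ => μ))
    (g h : Fin n → (Fin n → E) → ℝ)
    (hg : ∀ i x y, (∀ j, j ≠ i → x j = y j) → g i x = g i y)
    (hh : ∀ i, Integrable (h i) (Measure.pi fun _ => μ))
    (hfg : ∀ i, ∀ᵐ x ∂Measure.pi (fun _ => μ), (f x - g i x) ^ 2 ≤ h i x) :
    variance f (Measure.pi fun _ => μ) ≤ 2 * ∑ i, ∫ x, h i x ∂Measure.pi (fun _ => μ) := by
  set m : Measure (Fin n → E × E) := Measure.pi fun _ => μ.prod μ with hm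
  have hfst := measurePreserving_fst_pi (ι := Fin n) μ
  have hpres : ∀ S : Set (Fin n), MeasurePreserving (fun ω j => (swapOn S ω j).1) m
      (Measure.pi fun _ => μ) := fun S => hfst.comp (measurePreserving_swapOn μ S)
  -- `F S` is `f` with the coordinates in `S` taken from an independent copy of the sample.
  let F : Set (Fin n) → (Fin n → E × E) → ℝ := fun S ω => f fun j => (swapOn S ω j).1
  have hF : ∀ S, MemLp (F S) 2 m := fun S => hf.comp_measurePreserving (hpres S)
  have hFF : ∀ S T, Integrable (fun ω => F S ω * F T ω) m := fun S T => (hF S).integrable_mul (hF T)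
  have hFswap : ∀ S T ω, F S (swapOn T ω) = F (symmDiff S T) ω := by
    intro S T ω
    refine congrArg f (funext fun j => ?_)
    by_cases h1 : j ∈ S <;> by_cases h2 : j ∈ T <;> simp [swapOn, h1, h2, Set.mem_symmDiff]
  have hinv : ∀ (T : Set (Fin n)) (G : (Fin n → E × E) → ℝ), AEStronglyMeasurable G m →
      ∫ ω, G (swapOn T ω) ∂m = ∫ ω, G ω ∂m := by
    intro T G hG
    have hT := measurePreserving_swapOn μ T
    have hG' : AEStronglyMeasurable G (Measure.map (swapOn T) m) := by rwa [hT.map_eq]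
    rw [← integral_map hT.measurable.aemeasurable hG', hT.map_eq]
  -- the variance is a telescoping sum
  let S : ℕ → Set (Fin n) := fun l => {j | (j : ℕ) < l}
  have hS0 : S 0 = ∅ := by ext; simp [S]
  have hSn : S n = Set.univ := by ext j; simp [S]
  have hint : ∫ ω, F ∅ ω * F ∅ ω ∂m = ∫ x, f x ^ 2 ∂Measure.pi fun _ => μ := by
    have hsq : AEStronglyMeasurable (fun x => f x ^ 2) (Measure.pi fun _ : Fin n => μ) :=
      hf.aestronglyMeasurable.pow 2
    rw [← (hpres ∅).map_eq] at hsq ⊢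
    rw [integral_map (hpres ∅).measurable.aemeasurable hsq]
    simp [F, sq]
  have hprod : ∫ ω, F ∅ ω * F Set.univ ω ∂m = (∫ x, f x ∂Measure.pi fun _ => μ) ^ 2 := by
    have hA := measurePreserving_arrowProdEquivProdArrow E E (Fin n) (fun _ => μ) (fun _ => μ)
    have h1 := hA.integral_comp' (fun z : (Fin n → E) × (Fin n → E) => f z.1 * f z.2)
    rw [integral_prod_mul] at h1
    rw [sq, ← h1]
    refine integral_congr_ae (Filter.Eventually.of_forall fun ω => ?_)
    simp [F, swapOn, MeasurableEquiv.arrowProdEquivProdArrow, Equiv.arrowProdEquivProdArrow]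
  have hvar : variance f (Measure.pi fun _ => μ) =
      ∑ i : Fin n, ∫ ω, F ∅ ω * (F (S i) ω - F (S (i + 1)) ω) ∂m := by
    have h1 : ∀ i : ℕ, ∫ ω, F ∅ ω * (F (S i) ω - F (S (i + 1)) ω) ∂m =
        ∫ ω, F ∅ ω * F (S i) ω ∂m - ∫ ω, F ∅ ω * F (S (i + 1)) ω ∂m := by
      intro i
      rw [← integral_sub (hFF _ _) (hFF _ _)]
      simp_rw [mul_sub]
    simp_rw [h1]
    rw [Fin.sum_univ_eq_sum_range (fun i => ∫ ω, F ∅ ω * F (S i) ω ∂m -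
      ∫ ω, F ∅ ω * F (S (i + 1)) ω ∂m) n, Finset.sum_range_sub', hS0, hSn, hint, hprod,
      variance_eq_sub hf]
    rfl
  rw [hvar, Finset.mul_sum]
  refine Finset.sum_le_sum fun i _ => ?_
  have hsd : ∀ l : ℕ, (hl : l < n) → symmDiff (S l) {⟨l, hl⟩} = S (l + 1) := by
    intro l hl
    ext j
    simp only [S, Set.mem_symmDiff, Set.mem_ofPred_eq, Set.mem_singleton_iff, Fin.ext_iff]
    omega
  have hsd1 : symmDiff (S i) {i} = S (i + 1) := hsd i i.2
  have hsd2 : symmDiff (S (i + 1)) {i} = S i := by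
    rw [← hsd1, symmDiff_assoc, symmDiff_self, symmDiff_bot]
  have hemp : symmDiff ∅ {i} = ({i} : Set (Fin n)) := by simp
  have hm1 : ∀ A B C : Set (Fin n), Integrable (fun ω => F A ω * (F B ω - F C ω)) m := by
    intro A B C
    exact (hF A).integrable_mul ((hF B).sub (hF C))
  -- Exchanging the `i`-th pair swaps `S i` and `S (i + 1)`. Averaging both forms makes twice the
  -- summand equal to the expected product of the increments `F ∅ - F {i}` and `F (S i) - F (S (i +
  -- 1))`, which have equal second moments by `hDS`.
  have hsymm : ∫ ω, F ∅ ω * (F (S i) ω - F (S (i + 1)) ω) ∂m =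
      ∫ ω, F {i} ω * (F (S (i + 1)) ω - F (S i) ω) ∂m := by
    rw [← hinv {i} _ (hm1 _ _ _).aestronglyMeasurable]
    simp_rw [hFswap, hsd1, hsd2, hemp]
  have hD : ∀ A B : Set (Fin n), Integrable (fun ω => (F A ω - F B ω) ^ 2) m := fun A B =>
    ((hF A).sub (hF B)).integrable_sq
  have hDS : ∫ ω, (F (S i) ω - F (S (i + 1)) ω) ^ 2 ∂m = ∫ ω, (F ∅ ω - F {i} ω) ^ 2 ∂m := by
    rw [← hinv (S i) _ (hD ∅ {i}).aestronglyMeasurable]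
    simp_rw [hFswap]
    have e1 : symmDiff ∅ (S i) = S i := by simp
    have e2 : symmDiff {i} (S i) = S (i + 1) := by rw [symmDiff_comm, hsd1]
    rw [e1, e2]
  have hhi : ∀ A : Set (Fin n), Integrable (fun ω => h i fun j => (swapOn A ω j).1) m ∧
      ∫ ω, h i (fun j => (swapOn A ω j).1) ∂m = ∫ x, h i x ∂Measure.pi fun _ => μ := by
    intro A
    refine ⟨(hpres A).integrable_comp_of_integrable (hh i), ?_⟩
    have hsm : AEStronglyMeasurable (h i) (Measure.map (fun ω j => (swapOn A ω j).1) m) := by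
      rw [(hpres A).map_eq]; exact (hh i).aestronglyMeasurable
    rw [← integral_map (hpres A).measurable.aemeasurable hsm, (hpres A).map_eq]
  -- Resampling coordinate `i` does not change `g i`, so both values of `f` are compared with the
  -- same number; the factor `4` is `2 + 2` from `(a - b)² ≤ 2a² + 2b²`.
  have hbd : ∫ ω, (F ∅ ω - F {i} ω) ^ 2 ∂m ≤ 4 * ∫ x, h i x ∂Measure.pi fun _ => μ := by
    have h1 := (hpres ∅).quasiMeasurePreserving.ae (hfg i)
    have h2 := (hpres {i}).quasiMeasurePreserving.ae (hfg i)
    have : ∫ ω, (F ∅ ω - F {i} ω) ^ 2 ∂m ≤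
        ∫ ω, (2 * h i (fun j => (swapOn ∅ ω j).1) + 2 * h i (fun j => (swapOn {i} ω j).1)) ∂m := by
      refine integral_mono_ae (hD _ _)
        (((hhi ∅).1.const_mul 2).add ((hhi {i}).1.const_mul 2)) ?_
      filter_upwards [h1, h2] with ω h1 h2
      have he : g i (fun j => (swapOn ∅ ω j).1) = g i (fun j => (swapOn {i} ω j).1) := by
        refine hg i _ _ fun j hj => ?_
        simp [swapOn, hj]
      rw [← he] at h2
      simp only [F]
      nlinarith [sq_nonneg ((f fun j => (swapOn ∅ ω j).1) - g i (fun j => (swapOn ∅ ω j).1) +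
        ((f fun j => (swapOn {i} ω j).1) - g i (fun j => (swapOn ∅ ω j).1)))]
    refine this.trans (le_of_eq ?_)
    rw [integral_add ((hhi ∅).1.const_mul 2) ((hhi {i}).1.const_mul 2), integral_const_mul,
      integral_const_mul, (hhi _).2, (hhi _).2]
    ring
  have hmono : ∫ ω, F ∅ ω * (F (S i) ω - F (S (i + 1)) ω) ∂m +
      ∫ ω, F {i} ω * (F (S (i + 1)) ω - F (S i) ω) ∂m ≤
      ∫ ω, (1 / 2 * (F ∅ ω - F {i} ω) ^ 2 + 1 / 2 * (F (S i) ω - F (S (i + 1)) ω) ^ 2) ∂m := by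
    rw [← integral_add (hm1 _ _ _) (hm1 _ _ _)]
    refine integral_mono ((hm1 _ _ _).add (hm1 _ _ _))
      (((hD _ _).const_mul _).add ((hD _ _).const_mul _)) fun ω => ?_
    simp only
    nlinarith [sq_nonneg ((F ∅ ω - F {i} ω) - (F (S i) ω - F (S (i + 1)) ω))]
  rw [integral_add ((hD _ _).const_mul _) ((hD _ _).const_mul _), integral_const_mul,
    integral_const_mul, hDS, ← hsymm] at hmono
  linarith

end EfronStein

/-! ### Effect of deleting a sample point -/

section Deletion

variable {d N k : ℕ}

/-- The distance from the `j`-th point to its `k`-th nearest neighbour after deletion of the `i`-th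
point. -/
noncomputable def knnDistErase (k : ℕ) (x : Fin N → Fin d → ℝ) (i j : Fin N) : ℝ :=
  orderStat ((Finset.univ.erase j).erase i) k fun l => dist (x l) (x j)

theorem card_univ_erase_erase_fin {i j : Fin N} (hij : j ≠ i) :
    ((Finset.univ.erase j).erase i).card = N - 2 := by
  rw [Finset.card_erase_of_mem (Finset.mem_erase.2 ⟨hij.symm, Finset.mem_univ i⟩),
    card_univ_erase_fin]
  omega

theorem knnDistErase_congr {x y : Fin N → Fin d → ℝ} {i j : Fin N} (hij : j ≠ i)
    (h : ∀ l, l ≠ i → x l = y l) : knnDistErase k x i j = knnDistErase k y i j := by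
  unfold knnDistErase orderStat
  congr! 5 with r
  refine Finset.filter_congr fun l hl => ?_
  simp only [h l (Finset.ne_of_mem_erase hl), h j hij]

theorem measurable_knnDistErase (hk : 1 ≤ k) (hN : k + 2 ≤ N) {i j : Fin N} (hij : j ≠ i) :
    Measurable fun x : Fin N → Fin d → ℝ => knnDistErase k x i j := by
  refine measurable_orderStat (f := fun l (x : Fin N → Fin d → ℝ) => dist (x l) (x j)) hk
    (by rw [card_univ_erase_erase_fin hij]; omega) fun l _ => ?_
  exact (measurable_pi_apply l).dist (measurable_pi_apply j)

theorem knnDist_le_knnDistErase (hk : 1 ≤ k) (hN : k + 2 ≤ N) (x : Fin N → Fin d → ℝ)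
    {i j : Fin N} (hij : j ≠ i) : knnDist k x j ≤ knnDistErase k x i j := by
  rw [knnDist_eq_orderStat]
  exact orderStat_anti_set hk (by rw [card_univ_erase_erase_fin hij]; omega)
    (Finset.erase_subset _ _)

theorem knnDistErase_le_knnDist_succ (hk : 1 ≤ k) (hN : k + 2 ≤ N) (x : Fin N → Fin d → ℝ)
    (i j : Fin N) : knnDistErase k x i j ≤ knnDist (k + 1) x j := by
  rw [knnDist_eq_orderStat]
  exact orderStat_erase_le hk (by rw [card_univ_erase_fin]; omega) i

/-- Only `k` points influence the `k`-th nearest neighbour distance of a given point. -/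
theorem card_filter_knnDistErase_ne_le_left (hk : 1 ≤ k) (hN : k + 2 ≤ N)
    (x : Fin N → Fin d → ℝ) (j : Fin N) :
    ((Finset.univ.erase j).filter fun i => knnDistErase k x i j ≠ knnDist k x j).card ≤ k := by
  rw [knnDist_eq_orderStat]
  exact card_filter_erase_ne_le hk (by rw [card_univ_erase_fin]; omega) _

/-- Two points in the same orthant around `w` are no further from each other than from `w`. -/
theorem dist_le_of_same_orthant {u v w : Fin d → ℝ} (h : ∀ l, w l ≤ u l ↔ w l ≤ v l)
    (huv : dist u w ≤ dist v w) : dist u v ≤ dist w v := by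
  rw [dist_comm w v]
  refine (dist_pi_le_iff dist_nonneg).2 fun l => ?_
  have h1 := (dist_le_pi_dist u w l).trans huv
  have h2 := dist_le_pi_dist v w l
  have h3 := h l
  rw [Real.dist_eq, abs_le] at *
  by_cases hw : w l ≤ u l
  · have := h3.1 hw
    constructor <;> linarith
  · have : ¬ w l ≤ v l := fun h => hw (h3.2 h)
    constructor <;> linarith

/-- A point influences the `k`-th nearest neighbour distances of at most `2 ^ d * k` points. -/
theorem card_filter_knnDistErase_ne_le_right (hk : 1 ≤ k) (hN : k + 2 ≤ N)
    (x : Fin N → Fin d → ℝ) (i : Fin N) :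
    ((Finset.univ.erase i).filter fun j => knnDistErase k x i j ≠ knnDist k x j).card ≤
      2 ^ d * k := by
  classical
  -- Pigeonhole: sort the affected points by their orthant around `x i`. It remains to show that no
  -- orthant holds more than `k` of them.
  have h := Finset.card_le_mul_card_image_of_maps_to
    (s := (Finset.univ.erase i).filter fun j => knnDistErase k x i j ≠ knnDist k x j)
    (t := (Finset.univ : Finset (Fin d → Bool)))
    (f := fun j l => decide (x i l ≤ x j l)) (fun _ _ => Finset.mem_univ _) k ?_
  · simpa [mul_comm] using h
  intro b _
  by_contra! hcard
  set B := ((Finset.univ.erase i).filter fun j => knnDistErase k x i j ≠ knnDist k x j).filter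
    fun j => (fun l => decide (x i l ≤ x j l)) = b with hB
  -- Let `v` be the point of a crowded orthant farthest from `x i`. If `x i` is within the `k`-th
  -- neighbour distance of `v`, so are the at least `k` other points of the orthant; if not, `i` was
  -- never counted. Either way deleting `i` leaves `v` unaffected.
  obtain ⟨v, hv, hmax⟩ := Finset.exists_max_image B (fun j => dist (x j) (x i))
    (Finset.card_pos.1 (by omega))
  have hmem : ∀ u ∈ B, u ≠ i ∧ ∀ l, decide (x i l ≤ x u l) = b l := by
    intro u hu
    rw [hB, Finset.mem_filter, Finset.mem_filter] at hu
    exact ⟨Finset.ne_of_mem_erase hu.1.1, fun l => congrFun hu.2 l⟩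
  have hne : knnDistErase k x i v ≠ knnDist k x v := by
    rw [hB, Finset.mem_filter, Finset.mem_filter] at hv
    exact hv.1.2
  have hvi := (hmem v hv).1
  refine hne (le_antisymm ?_ (knnDist_le_knnDistErase hk hN x hvi))
  rw [knnDistErase, orderStat_le_iff hk (by rw [card_univ_erase_erase_fin hvi]; omega)]
  by_cases hD : dist (x i) (x v) ≤ knnDist k x v
  · have hsub : B.erase v ⊆ ((Finset.univ.erase v).erase i).filter
        fun l => dist (x l) (x v) ≤ knnDist k x v := by
      intro u hu
      rw [Finset.mem_erase] at hu
      simp only [Finset.mem_filter, Finset.mem_erase, Finset.mem_univ, and_true]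
      refine ⟨⟨(hmem u hu.2).1, hu.1⟩, (dist_le_of_same_orthant (fun l => ?_)
        (hmax u hu.2)).trans hD⟩
      rw [← decide_eq_decide, (hmem u hu.2).2 l, (hmem v hv).2 l]
    have := Finset.card_le_card hsub
    rw [Finset.card_erase_of_mem hv] at this
    omega
  · have hi : i ∉ (Finset.univ.erase v).filter fun l => dist (x l) (x v) ≤ knnDist k x v :=
      fun h => hD (Finset.mem_filter.1 h).2
    rw [Finset.filter_erase, Finset.erase_eq_of_notMem hi, knnDist_eq_orderStat]
    exact le_card_filter_le_orderStat hk (by rw [card_univ_erase_fin]; omega) _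

end Deletion

/-! ### Comparing log-volume and log-probability -/

section LogVolume

variable {d : ℕ} {p : (Fin d → ℝ) → ℝ} {C₁ C₂ : ℝ} {n N k : ℕ}

/-- The logarithm of the volume of the truncated ball around `y` of radius `r`. -/
noncomputable def logVol (y : Fin d → ℝ) (r : ℝ) : ℝ := ∑ j, Real.log (boxSide y r j)

theorem tKL_eq (k : ℕ) (x : Fin N → Fin d → ℝ) :
    tKL k x = -digamma k + digamma N + 1 / (N : ℝ) * ∑ i, logVol (x i) (knnDist k x i) := by
  simp only [tKL, logVol, truncSide_eq_boxSide]

theorem measurable_logVol : Measurable fun q : (Fin d → ℝ) × ℝ => logVol q.1 q.2 := by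
  unfold logVol boxSide
  fun_prop

theorem measurable_logVol_knnDist (hk : 1 ≤ k) (hN : k < N) (i : Fin N) :
    Measurable fun x : Fin N → Fin d → ℝ => logVol (x i) (knnDist k x i) := by
  have h := measurable_logVol.comp
    ((measurable_pi_apply (X := fun _ : Fin N => Fin d → ℝ) i).prodMk (measurable_knnDist hk hN i))
  exact h

theorem logVol_mono {y : Fin d → ℝ} (hy : y ∈ unitCube d) {r s : ℝ} (hr : 0 < r) (hrs : r ≤ s) :
    logVol y r ≤ logVol y s :=
  Finset.sum_le_sum fun j _ => Real.log_le_log (boxSide_pos hy hr j) (boxSide_mono hrs j)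

theorem log_prod_boxSide {y : Fin d → ℝ} (hy : y ∈ unitCube d) {r : ℝ} (hr : 0 < r) :
    Real.log (∏ j, boxSide y r j) = logVol y r :=
  Real.log_prod fun j _ => (boxSide_pos hy hr j).ne'

theorem abs_log_sub_log_le {a b c : ℝ} (hc : 0 < c) (ha : c ≤ a) (hb : c ≤ b) :
    |Real.log a - Real.log b| ≤ |a - b| / c := by
  have key : ∀ {a b : ℝ}, c ≤ a → c ≤ b → Real.log a - Real.log b ≤ |a - b| / c := by
    intro a b ha hb
    have ha0 := hc.trans_le ha
    have hb0 := hc.trans_le hb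
    rw [← Real.log_div ha0.ne' hb0.ne']
    calc Real.log (a / b) ≤ a / b - 1 := Real.log_le_sub_one_of_pos (div_pos ha0 hb0)
      _ = (a - b) / b := by field_simp
      _ ≤ |a - b| / b := by gcongr; exact le_abs_self _
      _ ≤ |a - b| / c := by gcongr
  rw [abs_le]
  have h1 := key ha hb
  have h2 := key hb ha
  rw [abs_sub_comm b a] at h2
  constructor <;> linarith

namespace IsAdmissibleDensity

variable (hp : IsAdmissibleDensity p C₁ C₂)
include hp

/-- `W / V` lies between `C₁` and `C`. This crude bound, uniform in `r`, reduces moments of `log V`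
to those of `log W`. -/
theorem abs_logVol_sub_log_ballMass_le {C : ℝ} (hC0 : 0 < C) (hC : ∀ x, p x ≤ C) {y : Fin d → ℝ}
    (hy : y ∈ unitCube d) {r : ℝ} (hr : 0 < r) :
    |logVol y r - Real.log (ballMass p y r)| ≤ |Real.log C₁| + |Real.log C| := by
  have hV : 0 < ∏ j, boxSide y r j := Finset.prod_pos fun j _ => boxSide_pos hy hr j
  have h1 := hp.le_ballMass hy hr.le
  have h2 := hp.ballMass_le hy hr.le hC
  have h3 := Real.log_le_log (mul_pos hp.pos hV) h1
  have h4 := Real.log_le_log ((mul_pos hp.pos hV).trans_le h1) h2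
  rw [Real.log_mul hp.pos.ne' hV.ne', log_prod_boxSide hy hr] at h3
  rw [Real.log_mul hC0.ne' hV.ne', log_prod_boxSide hy hr] at h4
  rw [abs_le]
  constructor
  · linarith [le_abs_self (Real.log C), abs_nonneg (Real.log C₁)]
  · linarith [neg_abs_le (Real.log C₁), abs_nonneg (Real.log C)]

/-- Both `p y` and the average `W / V` are at least `C₁`, and they differ by at most `C₂ r`; on
`[C₁, ∞)` the logarithm is `1 / C₁`-Lipschitz. -/
theorem abs_logVol_sub_log_ballMass_add_log_le {y : Fin d → ℝ} (hy : y ∈ unitCube d) {r : ℝ}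
    (hr : 0 < r) :
    |logVol y r - Real.log (ballMass p y r) + Real.log (p y)| ≤ C₂ / C₁ * r := by
  have hV : 0 < ∏ j, boxSide y r j := Finset.prod_pos fun j _ => boxSide_pos hy hr j
  have h1 := hp.le_ballMass hy hr.le
  have h2 := hp.abs_ballMass_sub_le hy hr.le
  have hM : 0 < ballMass p y r := (mul_pos hp.pos hV).trans_le h1
  have h3 : C₁ ≤ ballMass p y r / ∏ j, boxSide y r j := by rwa [le_div_iff₀ hV]
  have h4 := abs_log_sub_log_le hp.pos (hp.le_apply hy) h3
  rw [Real.log_div hM.ne' hV.ne', log_prod_boxSide hy hr] at h4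
  have h5 : |p y - ballMass p y r / ∏ j, boxSide y r j| ≤ C₂ * r := by
    have : p y - ballMass p y r / ∏ j, boxSide y r j =
        -((ballMass p y r - p y * ∏ j, boxSide y r j) / ∏ j, boxSide y r j) := by
      field_simp
      ring
    rw [this, abs_neg, abs_div, abs_of_pos hV, div_le_iff₀ hV]
    exact h2
  calc _ = |Real.log (p y) - (Real.log (ballMass p y r) - logVol y r)| := by congr 1; ring
    _ ≤ _ := h4
    _ ≤ C₂ * r / C₁ := by have := hp.pos; gcongr
    _ = C₂ / C₁ * r := by ring

theorem le_rpow_ballMass (hd : 1 ≤ d) {y : Fin d → ℝ} (hy : y ∈ unitCube d) {r : ℝ} (hr : 0 < r)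
    (hr1 : r ≤ 1) : r ≤ (ballMass p y r / C₁) ^ (1 / (d : ℝ)) := by
  have h1 := hp.le_ballMass hy hr.le
  have h2 : r ^ d ≤ ∏ j, boxSide y r j := by
    have := Finset.prod_le_prod (s := (Finset.univ : Finset (Fin d))) (f := fun _ => r)
      (fun _ _ => hr.le) fun j _ => le_boxSide hy hr.le hr1 j
    simpa using this
  have h3 : r ^ d ≤ ballMass p y r / C₁ := by
    rw [le_div_iff₀ hp.pos]
    nlinarith [hp.pos]
  have hd0 : (d : ℝ) ≠ 0 := by positivity
  calc r = (r ^ d) ^ (1 / (d : ℝ)) := by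
        rw [← Real.rpow_natCast, ← Real.rpow_mul hr.le, mul_one_div_cancel hd0, Real.rpow_one]
    _ ≤ _ := Real.rpow_le_rpow (by positivity) h3 (by positivity)

theorem ae_mem_unitCube_pi (N : ℕ) :
    ∀ᵐ x ∂Measure.pi (fun _ : Fin N => law p), ∀ i, x i ∈ unitCube d := by
  have := hp.isProbabilityMeasure_law
  rw [ae_all_iff]
  intro i
  exact (measurePreserving_eval (fun _ : Fin N => law p) i).quasiMeasurePreserving.ae
    hp.ae_mem_unitCube

theorem ae_knnMass_pos (hd : 1 ≤ d) (hk : 1 ≤ k) (hn : k ≤ n) :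
    ∀ᵐ x ∂Measure.pi (fun _ : Fin (n + 1) => law p), ∀ i, 0 < knnMass p k x i := by
  rw [ae_all_iff]
  intro i
  have h1 := (ae_orderStat_mem hk hn).mono fun u hu => hu.1
  have hs : MeasurableSet {t : ℝ | 0 < t} := measurableSet_Ioi
  rw [← ae_map_iff (p := fun t : ℝ => 0 < t) (measurable_orderStat_univ hk hn).aemeasurable hs,
    ← hp.map_knnMass hd hk hn i,
    ae_map_iff (hp.measurable_knnMass hk (by omega) i).aemeasurable hs] at h1
  exact h1

theorem ae_knnDist_mem (hd : 1 ≤ d) (hk : 1 ≤ k) (hn : k ≤ n) :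
    ∀ᵐ x ∂Measure.pi (fun _ : Fin (n + 1) => law p), ∀ i, knnDist k x i ∈ Set.Ioc (0 : ℝ) 1 := by
  filter_upwards [hp.ae_mem_unitCube_pi (n + 1), hp.ae_knnMass_pos hd hk hn] with x hx hW i
  constructor
  · by_contra! hr
    obtain ⟨C, hC0, hC⟩ := hp.exists_forall_le
    have h1 := (hW i).trans_le ((hp.ballMass_mono (x i) hr).trans
      (hp.ballMass_le (hx i) le_rfl hC))
    -- A ball of radius `0` would have zero volume, hence zero mass, against `W > 0`. For `d = 0`
    -- the product would be empty.
    have h2 : ∏ j, boxSide (x i) 0 j = 0 := by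
      refine Finset.prod_eq_zero (Finset.mem_univ ⟨0, hd⟩) ?_
      have := mem_unitCube_iff.1 (hx i) ⟨0, hd⟩
      simp [boxSide, this.1, this.2]
    rw [h2, mul_zero] at h1
    exact lt_irrefl _ h1
  · rw [knnDist_eq_orderStat]
    obtain ⟨j, -, hj⟩ := exists_orderStat_eq (s := Finset.univ.erase i) hk
      (by rw [card_univ_erase_fin]; omega) fun j => dist (x j) (x i)
    rw [hj]
    refine (dist_pi_le_iff zero_le_one).2 fun l => ?_
    have h1 := mem_unitCube_iff.1 (hx i) l
    have h2 := mem_unitCube_iff.1 (hx j) l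
    rw [Real.dist_eq, abs_le]
    constructor <;> linarith

theorem integrable_comp_knnMass (hd : 1 ≤ d) (hk : 1 ≤ k) (hn : k ≤ n) (i : Fin (n + 1))
    {φ : ℝ → ℝ} (hφ : Measurable φ)
    (h : Integrable (fun u => φ (orderStat Finset.univ k u)) (unifPi n)) :
    Integrable (fun x => φ (knnMass p k x i)) (Measure.pi fun _ : Fin (n + 1) => law p) := by
  have h1 := (integrable_map_measure (g := φ) hφ.aestronglyMeasurable
    (measurable_orderStat_univ hk hn).aemeasurable).2 h
  rw [← hp.map_knnMass hd hk hn i] at h1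
  exact (integrable_map_measure hφ.aestronglyMeasurable
    (hp.measurable_knnMass hk (by omega) i).aemeasurable).1 h1

theorem integral_comp_knnMass (hd : 1 ≤ d) (hk : 1 ≤ k) (hn : k ≤ n) (i : Fin (n + 1))
    {φ : ℝ → ℝ} (hφ : Measurable φ) :
    ∫ x, φ (knnMass p k x i) ∂Measure.pi (fun _ : Fin (n + 1) => law p) =
      ∫ u, φ (orderStat Finset.univ k u) ∂unifPi n := by
  rw [← integral_map (hp.measurable_knnMass hk (by omega) i).aemeasurable
    hφ.aestronglyMeasurable, hp.map_knnMass hd hk hn i,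
    integral_map (measurable_orderStat_univ hk hn).aemeasurable hφ.aestronglyMeasurable]

end IsAdmissibleDensity

end LogVolume

/-! ### Digamma values and second moments -/

section Moments

variable {d : ℕ} {p : (Fin d → ℝ) → ℝ} {C₁ C₂ : ℝ} {n N k : ℕ}

theorem digamma_succ_sub_digamma (hk : 1 ≤ k) (hn : k ≤ n) :
    digamma (n + 1 : ℕ) - digamma k = ∑ m ∈ Finset.Icc k n, 1 / (m : ℝ) := by
  have hdig : ∀ m : ℕ, digamma (m + 1 : ℕ) = -Real.eulerMascheroniConstant + harmonic m := by
    intro m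
    have h := Nat.cast_pos (α := ℝ) |>.2 m.factorial_pos
    rw [digamma, Nat.cast_add, Nat.cast_one, Real.deriv_Gamma_nat, Real.Gamma_nat_eq_factorial]
    field_simp
  obtain ⟨l, rfl⟩ : ∃ l, k = l + 1 := ⟨k - 1, by omega⟩
  rw [hdig, hdig]
  induction n, hn using Nat.le_induction with
  | base => simp [harmonic_succ]
  | succ n hn ih =>
    rw [Finset.sum_Icc_succ_top (by omega), ← ih, harmonic_succ]
    push_cast
    ring

namespace IsAdmissibleDensity

/-- A bound on the second moments of the centred logarithmic volumes. -/
noncomputable def momentBound (C₁ C : ℝ) (k : ℕ) : ℝ :=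
  2 * (|Real.log C₁| + |Real.log C|) ^ 2 + 2 * (k + 32)

theorem momentBound_nonneg (C₁ C : ℝ) (k : ℕ) : 0 ≤ momentBound C₁ C k := by
  unfold momentBound
  positivity

variable (hp : IsAdmissibleDensity p C₁ C₂)
include hp

/-- Adding `log N`, with `N = n + 1`, is the right centring: `log V + log N` differs from `log (N
W)` by a bounded amount. -/
theorem ae_sq_logVol_le {C : ℝ} (hC0 : 0 < C) (hC : ∀ x, p x ≤ C) (hd : 1 ≤ d) (hk : 1 ≤ k)
    (hn : k ≤ n) (i : Fin (n + 1)) :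
    ∀ᵐ x ∂Measure.pi (fun _ : Fin (n + 1) => law p),
      (logVol (x i) (knnDist k x i) + Real.log (n + 1)) ^ 2 ≤
        2 * (|Real.log C₁| + |Real.log C|) ^ 2 +
          2 * Real.log ((n + 1) * knnMass p k x i) ^ 2 := by
  filter_upwards [hp.ae_mem_unitCube_pi (n + 1), hp.ae_knnMass_pos hd hk hn,
    hp.ae_knnDist_mem hd hk hn] with x hx hW hr
  have h1 := hp.abs_logVol_sub_log_ballMass_le hC0 hC (hx i) (hr i).1
  have h2 := sq_le_sq' (neg_le_of_abs_le h1) (le_of_abs_le h1)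
  have h3 : Real.log ((n + 1) * knnMass p k x i) =
      Real.log (n + 1) + Real.log (ballMass p (x i) (knnDist k x i)) :=
    Real.log_mul (by positivity) (hW i).ne'
  rw [h3]
  nlinarith [sq_nonneg ((logVol (x i) (knnDist k x i) -
    Real.log (ballMass p (x i) (knnDist k x i))) - (Real.log (n + 1) +
      Real.log (ballMass p (x i) (knnDist k x i))))]

theorem integrable_sq_log_knnMass (hd : 1 ≤ d) (hk : 1 ≤ k) (hn : k ≤ n) (i : Fin (n + 1)) :
    Integrable (fun x => Real.log ((n + 1) * knnMass p k x i) ^ 2)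
      (Measure.pi fun _ : Fin (n + 1) => law p) :=
  hp.integrable_comp_knnMass hd hk hn i (φ := fun t => Real.log ((n + 1) * t) ^ 2) (by fun_prop)
    (integrable_sq_log_orderStat hk hn)

theorem integrable_sq_logVol (hd : 1 ≤ d) (hk : 1 ≤ k) (hn : k ≤ n) (i : Fin (n + 1)) :
    Integrable (fun x => (logVol (x i) (knnDist k x i) + Real.log (n + 1)) ^ 2)
      (Measure.pi fun _ : Fin (n + 1) => law p) := by
  have := hp.isProbabilityMeasure_law
  obtain ⟨C, hC0, hC⟩ := hp.exists_forall_le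
  refine Integrable.mono' ((integrable_const (2 * (|Real.log C₁| + |Real.log C|) ^ 2)).add
    ((hp.integrable_sq_log_knnMass hd hk hn i).const_mul 2))
    (((measurable_logVol_knnDist hk (by omega) i).add_const _).pow_const 2).aestronglyMeasurable ?_
  filter_upwards [hp.ae_sq_logVol_le hC0 hC hd hk hn i] with x hx
  rw [Real.norm_of_nonneg (sq_nonneg _)]
  exact hx

theorem integral_sq_logVol_le {C : ℝ} (hC0 : 0 < C) (hC : ∀ x, p x ≤ C) (hd : 1 ≤ d) (hk : 1 ≤ k)
    (hn : k ≤ n) (i : Fin (n + 1)) :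
    ∫ x, (logVol (x i) (knnDist k x i) + Real.log (n + 1)) ^ 2
      ∂Measure.pi (fun _ : Fin (n + 1) => law p) ≤ momentBound C₁ C k := by
  have := hp.isProbabilityMeasure_law
  have h0 := hp.integrable_sq_log_knnMass hd hk hn i
  have h1 := (integrable_const (μ := Measure.pi fun _ : Fin (n + 1) => law p)
    (2 * (|Real.log C₁| + |Real.log C|) ^ 2)).add (h0.const_mul 2)
  refine (integral_mono_ae (hp.integrable_sq_logVol hd hk hn i) h1
    (hp.ae_sq_logVol_le hC0 hC hd hk hn i)).trans ?_
  simp only [Pi.add_apply]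
  rw [integral_add (integrable_const _) (h0.const_mul 2), integral_const, integral_const_mul,
    hp.integral_comp_knnMass hd hk hn i (φ := fun t => Real.log ((n + 1) * t) ^ 2) (by fun_prop)]
  have := integral_sq_log_orderStat_le hk hn
  simp only [probReal_univ, one_smul, momentBound]
  linarith

theorem memLp_logVol (hd : 1 ≤ d) (hk : 1 ≤ k) (hn : k ≤ n) (i : Fin (n + 1)) :
    MemLp (fun x => logVol (x i) (knnDist k x i)) 2
      (Measure.pi fun _ : Fin (n + 1) => law p) := by
  have := hp.isProbabilityMeasure_law
  have hm := measurable_logVol_knnDist (d := d) hk (show k < n + 1 by omega) i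
  have h1 := (memLp_two_iff_integrable_sq (hm.add_const (Real.log (n + 1))).aestronglyMeasurable).2
    (hp.integrable_sq_logVol hd hk hn i)
  have h2 := h1.sub (memLp_const (Real.log (n + 1)))
  convert! h2 using 1
  ext x
  simp

theorem memLp_tKL (hd : 1 ≤ d) (hk : 1 ≤ k) (hn : k ≤ n) :
    MemLp (fun x : Fin (n + 1) → Fin d → ℝ => tKL k x) 2
      (Measure.pi fun _ : Fin (n + 1) => law p) := by
  have := hp.isProbabilityMeasure_law
  simp_rw [tKL_eq]
  have h1 := memLp_finsetSum Finset.univ fun i _ => hp.memLp_logVol hd hk hn i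
  have h2 := (memLp_const (p := 2) (μ := Measure.pi fun _ : Fin (n + 1) => law p)
    (-digamma k + digamma (n + 1 : ℕ))).add (h1.const_mul (1 / ((n + 1 : ℕ) : ℝ)))
  exact h2

end IsAdmissibleDensity

end Moments

/-! ### Bias -/

section Bias

variable {d : ℕ} {p : (Fin d → ℝ) → ℝ} {C₁ C₂ : ℝ} {n k : ℕ}

namespace IsAdmissibleDensity

variable (hp : IsAdmissibleDensity p C₁ C₂)
include hp

theorem integrable_log_knnMass (hd : 1 ≤ d) (hk : 1 ≤ k) (hn : k ≤ n) (i : Fin (n + 1)) :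
    Integrable (fun x => Real.log (knnMass p k x i))
      (Measure.pi fun _ : Fin (n + 1) => law p) :=
  hp.integrable_comp_knnMass hd hk hn i Real.measurable_log (integrable_log_orderStat hk hn)

theorem integrable_log_law : Integrable (fun y => Real.log (p y)) (law p) := by
  have := hp.isProbabilityMeasure_law
  obtain ⟨C, hC0, hC⟩ := hp.exists_forall_le
  refine Integrable.of_bound (Real.measurable_log.comp hp.measurable).aestronglyMeasurable
    (|Real.log C₁| + |Real.log C|) ?_
  filter_upwards [hp.ae_mem_unitCube] with y hy
  have h1 := Real.log_le_log hp.pos (hp.le_apply hy)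
  have h2 := Real.log_le_log (hp.pos.trans_le (hp.le_apply hy)) (hC y)
  rw [Real.norm_eq_abs, abs_le]
  constructor
  · linarith [neg_abs_le (Real.log C₁), abs_nonneg (Real.log C)]
  · linarith [le_abs_self (Real.log C), abs_nonneg (Real.log C₁)]

theorem integral_log_apply (N : ℕ) (i : Fin N) :
    Integrable (fun x => Real.log (p (x i))) (Measure.pi fun _ : Fin N => law p) ∧
    ∫ x, Real.log (p (x i)) ∂Measure.pi (fun _ : Fin N => law p) = -entropy p := by
  have := hp.isProbabilityMeasure_law
  have he := measurePreserving_eval (fun _ : Fin N => law p) i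
  refine ⟨he.integrable_comp_of_integrable hp.integrable_log_law, ?_⟩
  have hm : AEStronglyMeasurable (fun y => Real.log (p y))
      (Measure.map (Function.eval i) (Measure.pi fun _ : Fin N => law p)) := by
    rw [he.map_eq]
    exact hp.integrable_log_law.aestronglyMeasurable
  have h := integral_map he.measurable.aemeasurable hm
  rw [he.map_eq, hp.integral_law] at h
  rw [entropy, neg_neg, h]

/-- Jensen's inequality for the concave power `1 / d`, with `E W = k / (n + 1)`. -/
theorem integral_rpow_knnMass_le (hd : 1 ≤ d) (hk : 1 ≤ k) (hn : k ≤ n) (i : Fin (n + 1)) :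
    Integrable (fun x => (knnMass p k x i / C₁) ^ (1 / (d : ℝ)))
      (Measure.pi fun _ : Fin (n + 1) => law p) ∧
    ∫ x, (knnMass p k x i / C₁) ^ (1 / (d : ℝ)) ∂Measure.pi (fun _ : Fin (n + 1) => law p) ≤
      (k / (n + 1) / C₁) ^ (1 / (d : ℝ)) := by
  have hd1 : (1 : ℝ) ≤ d := by exact_mod_cast hd
  have hexp0 : (0 : ℝ) ≤ 1 / d := by positivity
  have hexp1 : 1 / (d : ℝ) ≤ 1 := by rw [div_le_one (by linarith)]; exact hd1
  have hmem := ae_orderStat_mem hk hn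
  have hm : Measurable fun t : ℝ => (t / C₁) ^ (1 / (d : ℝ)) := by fun_prop
  have hint : Integrable (fun u => (orderStat Finset.univ k u / C₁) ^ (1 / (d : ℝ)))
      (unifPi n) := by
    refine Integrable.of_bound (hm.comp (measurable_orderStat_univ hk hn)).aestronglyMeasurable
      ((1 / C₁) ^ (1 / (d : ℝ))) ?_
    filter_upwards [hmem] with u hu
    have := hp.pos
    have := hu.1
    rw [Real.norm_of_nonneg (by positivity)]
    exact Real.rpow_le_rpow (by positivity) (by gcongr; exact hu.2) hexp0
  refine ⟨hp.integrable_comp_knnMass hd hk hn i hm hint, ?_⟩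
  rw [hp.integral_comp_knnMass hd hk hn i hm, ← integral_orderStat hk hn, ← integral_div]
  refine (Real.concaveOn_rpow hexp0 hexp1).le_map_integral ?_ isClosed_Ici ?_
    ((integrable_orderStat hk hn).div_const _) hint
  · exact (Real.continuous_rpow_const hexp0).continuousOn
  · filter_upwards [hmem] with u hu
    exact div_nonneg hu.1.le hp.pos.le

theorem abs_integral_logVol_sub_le (hd : 1 ≤ d) (hk : 1 ≤ k) (hn : k ≤ n) (i : Fin (n + 1)) :
    |(∫ x, logVol (x i) (knnDist k x i) ∂Measure.pi (fun _ : Fin (n + 1) => law p)) +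
        ∑ m ∈ Finset.Icc k n, 1 / (m : ℝ) - entropy p| ≤
      C₂ / C₁ * (k / (n + 1) / C₁) ^ (1 / (d : ℝ)) := by
  have := hp.isProbabilityMeasure_law
  have hL := (hp.memLp_logVol hd hk hn i).integrable one_le_two
  have hW := hp.integrable_log_knnMass hd hk hn i
  obtain ⟨hP, hPint⟩ := hp.integral_log_apply (n + 1) i
  obtain ⟨hR, hRint⟩ := hp.integral_rpow_knnMass_le hd hk hn i
  have hc : 0 ≤ C₂ / C₁ := div_nonneg hp.lipschitz_const_nonneg hp.pos.le
  have hWint : ∫ x, Real.log (knnMass p k x i) ∂Measure.pi (fun _ : Fin (n + 1) => law p) =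
      -∑ m ∈ Finset.Icc k n, 1 / (m : ℝ) := by
    rw [hp.integral_comp_knnMass hd hk hn i Real.measurable_log, integral_log_orderStat hk hn]
  have hsum : ∫ x, (logVol (x i) (knnDist k x i) - Real.log (knnMass p k x i) +
      Real.log (p (x i))) ∂Measure.pi (fun _ : Fin (n + 1) => law p) =
      (∫ x, logVol (x i) (knnDist k x i) ∂Measure.pi (fun _ : Fin (n + 1) => law p)) +
        ∑ m ∈ Finset.Icc k n, 1 / (m : ℝ) - entropy p := by
    have h1 := integral_add (hL.sub hW) hP
    simp only [Pi.sub_apply] at h1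
    rw [h1, integral_sub hL hW, hWint, hPint]
    ring
  rw [← hsum, ← Real.norm_eq_abs]
  calc _ ≤ ∫ x, C₂ / C₁ * (knnMass p k x i / C₁) ^ (1 / (d : ℝ))
        ∂Measure.pi (fun _ : Fin (n + 1) => law p) := by
        refine norm_integral_le_of_norm_le (hR.const_mul _) ?_
        filter_upwards [hp.ae_mem_unitCube_pi (n + 1), hp.ae_knnDist_mem hd hk hn] with x hx hr
        rw [Real.norm_eq_abs]
        refine (hp.abs_logVol_sub_log_ballMass_add_log_le (hx i) (hr i).1).trans ?_
        exact mul_le_mul_of_nonneg_left (hp.le_rpow_ballMass hd (hx i) (hr i).1 (hr i).2) hc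
    _ ≤ _ := by
        rw [integral_const_mul]
        exact mul_le_mul_of_nonneg_left hRint hc

/-- The bias of the truncated Kozachenko–Leonenko estimator. -/
theorem abs_integral_tKL_sub_entropy_le (hd : 1 ≤ d) (hk : 1 ≤ k) (hn : k ≤ n) :
    |(∫ x, tKL k x ∂Measure.pi (fun _ : Fin (n + 1) => law p)) - entropy p| ≤
      C₂ / C₁ ^ (1 + 1 / (d : ℝ)) * ((k : ℝ) / ((n + 1 : ℕ) : ℝ)) ^ (1 / (d : ℝ)) := by
  have := hp.isProbabilityMeasure_law
  have hN : (0 : ℝ) < (n + 1 : ℕ) := by positivity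
  have hL : ∀ i ∈ (Finset.univ : Finset (Fin (n + 1))),
      Integrable (fun x => logVol (x i) (knnDist k x i))
        (Measure.pi fun _ : Fin (n + 1) => law p) :=
    fun i _ => (hp.memLp_logVol hd hk hn i).integrable one_le_two
  have hrhs : C₂ / C₁ ^ (1 + 1 / (d : ℝ)) * ((k : ℝ) / ((n + 1 : ℕ) : ℝ)) ^ (1 / (d : ℝ)) =
      C₂ / C₁ * (k / (n + 1) / C₁) ^ (1 / (d : ℝ)) := by
    rw [Real.div_rpow (by positivity) hp.pos.le, Real.rpow_add hp.pos, Real.rpow_one]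
    have h1 := hp.pos
    have h2 := Real.rpow_pos_of_pos hp.pos (1 / (d : ℝ))
    push_cast
    field_simp
  -- The digamma difference is exactly the harmonic sum `-E log W`, so the bias is the average of
  -- the `N` single-point errors.
  have hlhs : (∫ x, tKL k x ∂Measure.pi (fun _ : Fin (n + 1) => law p)) - entropy p =
      1 / ((n + 1 : ℕ) : ℝ) * ∑ i : Fin (n + 1),
        ((∫ x, logVol (x i) (knnDist k x i) ∂Measure.pi (fun _ : Fin (n + 1) => law p)) +
          ∑ m ∈ Finset.Icc k n, 1 / (m : ℝ) - entropy p) := by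
    simp_rw [tKL_eq]
    rw [integral_add (integrable_const _) ((integrable_finsetSum _ hL).const_mul _),
      integral_const, integral_const_mul, integral_finsetSum _ hL,
      ← digamma_succ_sub_digamma hk hn, Finset.sum_sub_distrib, Finset.sum_add_distrib]
    simp only [probReal_univ, one_smul, Finset.sum_const, Finset.card_univ, Fintype.card_fin,
      nsmul_eq_mul]
    field_simp
    ring
  rw [hrhs, hlhs, abs_mul, abs_of_pos (by positivity), one_div, inv_mul_le_iff₀ hN]
  refine (Finset.abs_sum_le_sum_abs _ _).trans ?_
  refine (Finset.sum_le_sum fun i _ => hp.abs_integral_logVol_sub_le hd hk hn i).trans ?_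
  simp

end IsAdmissibleDensity

end Bias

/-! ### Variance -/

section Variance

variable {d : ℕ} {p : (Fin d → ℝ) → ℝ} {C₁ C₂ : ℝ} {n N k : ℕ}

/-- The increase of the logarithmic volume from the `k`-th to the next nearest neighbour. -/
noncomputable def logVolGap (k : ℕ) (x : Fin N → Fin d → ℝ) (j : Fin N) : ℝ :=
  logVol (x j) (knnDist (k + 1) x j) - logVol (x j) (knnDist k x j)

/-- The samples for which deleting the `i`-th point changes the `k`-th nearest neighbour distance
of the `j`-th point. -/
def influenceSet (d k : ℕ) (i j : Fin N) : Set (Fin N → Fin d → ℝ) :=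
  {x | knnDistErase k x i j ≠ knnDist k x j}

open Classical in
/-- The squared gaps of the points influenced by the `i`-th point. -/
noncomputable def influencedGap (k : ℕ) (i : Fin N) (x : Fin N → Fin d → ℝ) : ℝ :=
  ∑ j ∈ Finset.univ.erase i, (influenceSet d k i j).indicator (fun x => logVolGap k x j ^ 2) x

/-- Cauchy–Schwarz over the at most `2 ^ d * k` nonzero terms. By monotonicity each change is at
most the gap to the next neighbour, which does not involve `i`. -/
theorem sq_sum_logVol_sub_le (hk : 1 ≤ k) (hN : k + 2 ≤ N) {x : Fin N → Fin d → ℝ}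
    (hx : ∀ i, x i ∈ unitCube d) (hr : ∀ i, 0 < knnDist k x i) (i : Fin N) :
    (∑ j ∈ Finset.univ.erase i,
      (logVol (x j) (knnDist k x j) - logVol (x j) (knnDistErase k x i j))) ^ 2 ≤
      (2 ^ d * k : ℕ) * influencedGap k i x := by
  classical
  set A := (Finset.univ.erase i).filter fun j => knnDistErase k x i j ≠ knnDist k x j with hA
  have h1 : ∑ j ∈ Finset.univ.erase i,
      (logVol (x j) (knnDist k x j) - logVol (x j) (knnDistErase k x i j)) =
      ∑ j ∈ A, (logVol (x j) (knnDist k x j) - logVol (x j) (knnDistErase k x i j)) := by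
    rw [hA, Finset.sum_filter]
    refine Finset.sum_congr rfl fun j _ => ?_
    split_ifs with h
    · rfl
    · rw [not_not.1 h, sub_self]
  have h2 : influencedGap k i x = ∑ j ∈ A, logVolGap k x j ^ 2 := by
    rw [hA, Finset.sum_filter]
    refine Finset.sum_congr rfl fun j _ => ?_
    rw [Set.indicator_apply]
    exact if_congr Iff.rfl rfl rfl
  rw [h1, h2]
  refine sq_sum_le_card_mul_sum_sq.trans ?_
  refine mul_le_mul (Nat.cast_le.2 (card_filter_knnDistErase_ne_le_right hk hN x i))
    (Finset.sum_le_sum fun j hj => ?_) (Finset.sum_nonneg fun _ _ => sq_nonneg _)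
    (Nat.cast_nonneg _)
  have hji : j ≠ i := Finset.ne_of_mem_erase (Finset.mem_filter.1 hj).1
  have hle := knnDist_le_knnDistErase hk hN x hji
  have h3 := logVol_mono (hx j) (hr j) hle
  have h4 := logVol_mono (hx j) ((hr j).trans_le hle) (knnDistErase_le_knnDist_succ hk hN x i j)
  unfold logVolGap
  nlinarith

/-- Which points `i` influences is random and correlated with the gaps. Summing over `i` and
exchanging the sums avoids this: each `j` is counted at most `k` times. -/
theorem sum_influencedGap_le (hk : 1 ≤ k) (hN : k + 2 ≤ N) (x : Fin N → Fin d → ℝ) :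
    ∑ i, influencedGap k i x ≤ k * ∑ j, logVolGap k x j ^ 2 := by
  classical
  have h1 : ∑ i, influencedGap k i x = ∑ j, ∑ i ∈ Finset.univ.erase j,
      if knnDistErase k x i j ≠ knnDist k x j then logVolGap k x j ^ 2 else 0 := by
    unfold influencedGap
    rw [Finset.sum_comm' (t' := Finset.univ) (s' := fun j => Finset.univ.erase j)]
    · refine Finset.sum_congr rfl fun j _ => Finset.sum_congr rfl fun i _ => ?_
      rw [Set.indicator_apply]
      exact if_congr Iff.rfl rfl rfl
    · intro i j
      simp [eq_comm]
  rw [h1, Finset.mul_sum]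
  refine Finset.sum_le_sum fun j _ => ?_
  rw [← Finset.sum_filter, Finset.sum_const, nsmul_eq_mul]
  exact mul_le_mul_of_nonneg_right
    (Nat.cast_le.2 (card_filter_knnDistErase_ne_le_left hk hN x j)) (sq_nonneg _)

theorem measurableSet_influenceSet (hk : 1 ≤ k) (hN : k + 2 ≤ N) {i j : Fin N} (hij : j ≠ i) :
    MeasurableSet (influenceSet d k i j) :=
  (measurableSet_eq_fun (measurable_knnDistErase hk hN hij)
    (measurable_knnDist hk (by omega) j)).compl

/-- The estimate with the contribution of the `i`-th point replaced by a constant and all nearest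
neighbour distances computed without the `i`-th point. -/
noncomputable def tKLErase (k : ℕ) (i : Fin N) (x : Fin N → Fin d → ℝ) : ℝ :=
  -- `-log N` is the typical size of the missing log-volume: the difference has second moment
  -- bounded in `N`.
  -digamma k + digamma N + 1 / (N : ℝ) * (-Real.log N +
    ∑ j ∈ Finset.univ.erase i, logVol (x j) (knnDistErase k x i j))

theorem tKLErase_congr {x y : Fin N → Fin d → ℝ} {i : Fin N} (h : ∀ j, j ≠ i → x j = y j) :
    tKLErase k i x = tKLErase k i y := by
  unfold tKLErase
  congr 3
  refine Finset.sum_congr rfl fun j hj => ?_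
  have hji := Finset.ne_of_mem_erase hj
  rw [h j hji, knnDistErase_congr hji h]

theorem tKL_sub_tKLErase (k : ℕ) (i : Fin N) (x : Fin N → Fin d → ℝ) :
    tKL k x - tKLErase k i x = 1 / (N : ℝ) * ((logVol (x i) (knnDist k x i) + Real.log N) +
      ∑ j ∈ Finset.univ.erase i,
        (logVol (x j) (knnDist k x j) - logVol (x j) (knnDistErase k x i j))) := by
  rw [tKL_eq, tKLErase, Finset.sum_sub_distrib,
    ← Finset.add_sum_erase Finset.univ (fun i => logVol (x i) (knnDist k x i)) (Finset.mem_univ i)]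
  ring

namespace IsAdmissibleDensity

variable (hp : IsAdmissibleDensity p C₁ C₂)
include hp

theorem integrable_sq_logVolGap (hd : 1 ≤ d) (hk : 1 ≤ k) (hn : k + 1 ≤ n) (j : Fin (n + 1)) :
    Integrable (fun x => logVolGap k x j ^ 2) (Measure.pi fun _ : Fin (n + 1) => law p) := by
  have h := (hp.memLp_logVol hd (by omega) hn j).sub (hp.memLp_logVol hd hk (by omega) j)
  exact h.integrable_sq

theorem integral_sq_logVolGap_le {C : ℝ} (hC0 : 0 < C) (hC : ∀ x, p x ≤ C) (hd : 1 ≤ d)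
    (hk : 1 ≤ k) (hn : k + 1 ≤ n) (j : Fin (n + 1)) :
    ∫ x, logVolGap k x j ^ 2 ∂Measure.pi (fun _ : Fin (n + 1) => law p) ≤
      2 * momentBound C₁ C (k + 1) + 2 * momentBound C₁ C k := by
  have h1 := (hp.integrable_sq_logVol hd (show 1 ≤ k + 1 by omega) hn j).const_mul 2
  have h2 := (hp.integrable_sq_logVol hd hk (show k ≤ n by omega) j).const_mul 2
  have h3 := hp.integral_sq_logVol_le hC0 hC hd (show 1 ≤ k + 1 by omega) hn j
  have h4 := hp.integral_sq_logVol_le hC0 hC hd hk (show k ≤ n by omega) j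
  have h5 := integral_mono (hp.integrable_sq_logVolGap hd hk hn j) (h1.add h2) fun x => by
    simp only [Pi.add_apply, logVolGap]
    nlinarith [sq_nonneg ((logVol (x j) (knnDist (k + 1) x j) + Real.log (n + 1)) +
      (logVol (x j) (knnDist k x j) + Real.log (n + 1)))]
  simp only [Pi.add_apply] at h5
  rw [integral_add h1 h2, integral_const_mul, integral_const_mul] at h5
  linarith

theorem integrable_influencedGap (hd : 1 ≤ d) (hk : 1 ≤ k) (hn : k + 1 ≤ n) (i : Fin (n + 1)) :
    Integrable (influencedGap k i) (Measure.pi fun _ : Fin (n + 1) => law p) := by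
  unfold influencedGap
  exact integrable_finsetSum _ fun j hj => (hp.integrable_sq_logVolGap hd hk hn j).indicator
    (measurableSet_influenceSet hk (by omega) (Finset.ne_of_mem_erase hj))

/-- Efron–Stein with `tKLErase`; `k + 1 ≤ n` ensures `k` neighbours after a deletion. The factor `4`
is `2` from Efron–Stein times `2` from `(a + b)² ≤ 2a² + 2b²`. -/
theorem variance_tKL_le_of_succ_le {C : ℝ} (hC0 : 0 < C) (hC : ∀ x, p x ≤ C) (hd : 1 ≤ d)
    (hk : 1 ≤ k) (hn : k + 1 ≤ n) :
    variance (fun x : Fin (n + 1) → Fin d → ℝ => tKL k x) (Measure.pi fun _ => law p) ≤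
      4 * (momentBound C₁ C k + (2 ^ d * k : ℕ) * (k * (2 * momentBound C₁ C (k + 1) +
        2 * momentBound C₁ C k))) * (1 / ((n + 1 : ℕ) : ℝ)) := by
  have := hp.isProbabilityMeasure_law
  have hN : (0 : ℝ) < n + 1 := by positivity
  set K : ℝ := ((2 ^ d * k : ℕ) : ℝ) with hK
  have hK0 : 0 ≤ K := Nat.cast_nonneg _
  set m := Measure.pi fun _ : Fin (n + 1) => law p
  let S : Fin (n + 1) → (Fin (n + 1) → Fin d → ℝ) → ℝ := fun i x =>
    (logVol (x i) (knnDist k x i) + Real.log (n + 1)) ^ 2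
  have hS : ∀ i, Integrable (S i) m := fun i => hp.integrable_sq_logVol hd hk (by omega) i
  have hG : ∀ i, Integrable (influencedGap k i) m := hp.integrable_influencedGap hd hk hn
  have hD : ∀ j, Integrable (fun x => logVolGap k x j ^ 2) m :=
    hp.integrable_sq_logVolGap hd hk hn
  let h : Fin (n + 1) → (Fin (n + 1) → Fin d → ℝ) → ℝ := fun i x =>
    2 / (n + 1) ^ 2 * (S i x + K * influencedGap k i x)
  have hh : ∀ i, Integrable (h i) m := fun i => ((hS i).add ((hG i).const_mul K)).const_mul _
  have hES := variance_pi_le_of_update (law p) (hp.memLp_tKL hd hk (show k ≤ n by omega))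
    (tKLErase k) h (fun i x y hxy => tKLErase_congr hxy) hh fun i => by
      filter_upwards [hp.ae_mem_unitCube_pi (n + 1),
        hp.ae_knnDist_mem hd hk (show k ≤ n by omega)] with x hx hr
      have h1 := sq_sum_logVol_sub_le hk (by omega) hx (fun i => (hr i).1) i
      rw [tKL_sub_tKLErase, mul_pow]
      push_cast at h1 ⊢
      have h2 : 2 / ((n : ℝ) + 1) ^ 2 * (S i x + K * influencedGap k i x) =
          (1 / ((n : ℝ) + 1)) ^ 2 * (2 * (S i x + K * influencedGap k i x)) := by
        field_simp
      simp only [h]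
      rw [h2]
      refine mul_le_mul_of_nonneg_left ?_ (sq_nonneg _)
      have h3 : ∀ a b c : ℝ, b ^ 2 ≤ c → (a + b) ^ 2 ≤ 2 * (a ^ 2 + c) := by
        intro a b c hbc
        nlinarith [sq_nonneg (a - b)]
      refine h3 _ _ _ (h1.trans (le_of_eq ?_))
      rw [hK]
      push_cast
      rfl
  have hbound : ∑ i, ∫ x, h i x ∂m ≤ 2 / (n + 1) ^ 2 * ((n + 1) * momentBound C₁ C k +
      K * (k * ((n + 1) * (2 * momentBound C₁ C (k + 1) + 2 * momentBound C₁ C k)))) := by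
    have h1 : ∀ i, ∫ x, h i x ∂m =
        2 / (n + 1) ^ 2 * (∫ x, S i x ∂m + K * ∫ x, influencedGap k i x ∂m) := by
      intro i
      simp only [h]
      rw [integral_const_mul, integral_add (hS i) ((hG i).const_mul K), integral_const_mul]
    have h2 : ∑ i, ∫ x, S i x ∂m ≤ (n + 1) * momentBound C₁ C k := by
      refine (Finset.sum_le_sum fun i _ =>
        hp.integral_sq_logVol_le hC0 hC hd hk (by omega) i).trans (le_of_eq ?_)
      simp
    have h3 : ∑ i, ∫ x, influencedGap k i x ∂m ≤
        k * ((n + 1) * (2 * momentBound C₁ C (k + 1) + 2 * momentBound C₁ C k)) := by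
      rw [← integral_finsetSum _ fun i _ => hG i]
      refine (integral_mono (integrable_finsetSum _ fun i _ => hG i)
        ((integrable_finsetSum Finset.univ fun j _ => hD j).const_mul (k : ℝ))
        fun x => sum_influencedGap_le hk (by omega) x).trans ?_
      rw [integral_const_mul, integral_finsetSum _ fun j _ => hD j]
      refine mul_le_mul_of_nonneg_left ?_ (Nat.cast_nonneg k)
      refine (Finset.sum_le_sum fun j _ =>
        hp.integral_sq_logVolGap_le hC0 hC hd hk hn j).trans (le_of_eq ?_)
      simp [mul_add]
    simp_rw [h1]
    rw [← Finset.mul_sum, Finset.sum_add_distrib, ← Finset.mul_sum]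
    gcongr
  refine hES.trans ((mul_le_mul_of_nonneg_left hbound zero_le_two).trans (le_of_eq ?_))
  push_cast
  field_simp
  ring

/-- A bound without decay, from Cauchy–Schwarz on the average of the centred log-volumes. It is
needed only for `N = k + 1`. -/
theorem variance_tKL_le {C : ℝ} (hC0 : 0 < C) (hC : ∀ x, p x ≤ C) (hd : 1 ≤ d)
    (hk : 1 ≤ k) (hn : k ≤ n) :
    variance (fun x : Fin (n + 1) → Fin d → ℝ => tKL k x) (Measure.pi fun _ => law p) ≤
      momentBound C₁ C k := by
  have := hp.isProbabilityMeasure_law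
  have hN : (0 : ℝ) < n + 1 := by positivity
  set m := Measure.pi fun _ : Fin (n + 1) => law p
  let S : Fin (n + 1) → (Fin (n + 1) → Fin d → ℝ) → ℝ := fun i x =>
    logVol (x i) (knnDist k x i) + Real.log (n + 1)
  have hS : ∀ i, Integrable (fun x => S i x ^ 2) m := fun i => hp.integrable_sq_logVol hd hk hn i
  have hm : AEStronglyMeasurable (fun x : Fin (n + 1) → Fin d → ℝ => tKL k x) m :=
    (hp.memLp_tKL hd hk hn).aestronglyMeasurable
  have hshift : ∀ x : Fin (n + 1) → Fin d → ℝ,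
      tKL k x - (-digamma k + digamma (n + 1 : ℕ) - Real.log (n + 1)) =
        1 / (n + 1) * ∑ i, S i x := by
    intro x
    rw [tKL_eq, Finset.sum_add_distrib]
    simp only [Finset.sum_const, Finset.card_univ, Fintype.card_fin, nsmul_eq_mul]
    push_cast
    field_simp
    ring
  rw [← variance_sub_const hm (-digamma k + digamma (n + 1 : ℕ) - Real.log (n + 1))]
  simp_rw [hshift]
  have hm' : AEStronglyMeasurable (fun x => 1 / ((n : ℝ) + 1) * ∑ i, S i x) m := by
    simp_rw [← hshift]
    exact hm.sub aestronglyMeasurable_const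
  refine (variance_le_expectation_sq hm').trans ?_
  have h1 : ∀ x, (1 / ((n : ℝ) + 1) * ∑ i, S i x) ^ 2 ≤ 1 / (n + 1) * ∑ i, S i x ^ 2 := by
    intro x
    have h := sq_sum_le_card_mul_sum_sq (s := Finset.univ) (f := fun i => S i x)
    rw [Finset.card_univ, Fintype.card_fin] at h
    push_cast at h
    calc (1 / ((n : ℝ) + 1) * ∑ i, S i x) ^ 2
        = (1 / (n + 1)) ^ 2 * (∑ i, S i x) ^ 2 := mul_pow _ _ _
      _ ≤ (1 / (n + 1)) ^ 2 * ((n + 1) * ∑ i, S i x ^ 2) := by gcongr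
      _ = _ := by field_simp
  have h2 : Integrable (fun x => 1 / ((n : ℝ) + 1) * ∑ i, S i x ^ 2) m :=
    (integrable_finsetSum _ fun i _ => hS i).const_mul _
  refine (integral_mono_of_nonneg (Filter.Eventually.of_forall fun x => sq_nonneg _) h2
    (Filter.Eventually.of_forall h1)).trans ?_
  rw [integral_const_mul, integral_finsetSum _ fun i _ => hS i, one_div, inv_mul_le_iff₀ hN]
  refine (Finset.sum_le_sum fun i _ =>
    hp.integral_sq_logVol_le hC0 hC hd hk hn i).trans (le_of_eq ?_)
  simp

theorem exists_variance_tKL_le (hd : 1 ≤ d) (hk : 1 ≤ k) :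
    ∃ C : ℝ, 0 < C ∧ ∀ n, k ≤ n →
      variance (fun x : Fin (n + 1) → Fin d → ℝ => tKL k x) (Measure.pi fun _ => law p) ≤
        C * (1 / ((n + 1 : ℕ) : ℝ)) := by
  obtain ⟨C, hC0, hC⟩ := hp.exists_forall_le
  have hM := momentBound_nonneg C₁ C k
  have hM' := momentBound_nonneg C₁ C (k + 1)
  set A := 4 * (momentBound C₁ C k + (2 ^ d * k : ℕ) * (k * (2 * momentBound C₁ C (k + 1) +
    2 * momentBound C₁ C k))) with hA
  have hA0 : 0 ≤ A := by positivity
  have hB0 : 0 ≤ (k + 1) * momentBound C₁ C k := by positivity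
  -- `A` serves `N ≥ k + 2`, the second term serves `N = k + 1` by multiplying the crude bound by
  -- `N`, and `1` makes the constant positive.
  refine ⟨A + (k + 1) * momentBound C₁ C k + 1, by linarith, fun n hn => ?_⟩
  have hN : (0 : ℝ) < ((n + 1 : ℕ) : ℝ) := by positivity
  rcases hn.eq_or_lt with rfl | hlt
  · refine (hp.variance_tKL_le hC0 hC hd hk le_rfl).trans ?_
    rw [mul_one_div, le_div_iff₀ hN]
    push_cast
    linarith
  · refine (hp.variance_tKL_le_of_succ_le hC0 hC hd hk hlt).trans ?_
    gcongr
    linarith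

end IsAdmissibleDensity

end Variance

end TruncatedKL

/-! ### Transfer to samples on an arbitrary probability space -/

theorem theorem1 {d k : ℕ} (hd : 1 ≤ d) (hk : 1 ≤ k)
    (p : (Fin d → ℝ) → ℝ) (C₁ C₂ : ℝ) (hp : TruncatedKL.IsAdmissibleDensity p C₁ C₂) :
    ∃ C : ℝ, 0 < C ∧
      ∀ N : ℕ, k < N →
      ∀ (Ω : Type*) [MeasurableSpace Ω] (P : Measure Ω) [IsProbabilityMeasure P]
        (X : Fin N → Ω → Fin d → ℝ),
        iIndepFun X P → (∀ i, HasLaw (X i) (TruncatedKL.law p) P) →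
        MemLp (fun ω => TruncatedKL.tKL k fun i => X i ω) 2 P ∧
        |(∫ ω, TruncatedKL.tKL k (fun i => X i ω) ∂P) - TruncatedKL.entropy p| ≤
          C₂ / C₁ ^ (1 + 1 / (d : ℝ)) * ((k : ℝ) / (N : ℝ)) ^ (1 / (d : ℝ)) ∧
        variance (fun ω => TruncatedKL.tKL k fun i => X i ω) P ≤ C * (1 / (N : ℝ)) := by
  obtain ⟨C, hC0, hC⟩ := hp.exists_variance_tKL_le hd hk
  refine ⟨C, hC0, fun N hN Ω _ P _ X hind hlaw => ?_⟩
  obtain ⟨n, rfl⟩ : ∃ n, N = n + 1 := ⟨N - 1, by omega⟩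
  have hn : k ≤ n := by omega
  -- Independence makes the joint law of the sample the product measure, and all three claims depend
  -- only on that law.
  have hlawX : HasLaw (fun ω i => X i ω) (Measure.pi fun _ : Fin (n + 1) => TruncatedKL.law p) P :=
    hind.hasLaw_pi hlaw
  have hmem := hp.memLp_tKL hd hk hn
  have hmem' := hmem
  rw [← hlawX.map_eq] at hmem'
  refine ⟨hmem'.comp_of_map hlawX.aemeasurable, ?_, ?_⟩
  · have h := hp.abs_integral_tKL_sub_entropy_le hd hk hn
    rw [← hlawX.integral_comp hmem.aestronglyMeasurable] at h
    exact h
  · have h := hC n hn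
    rw [← hlawX.map_eq, variance_map hmem'.aestronglyMeasurable.aemeasurable
      hlawX.aemeasurable] at h
    exact h
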